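/- Fix the standard numbering of the partial computable functions $\varphi_e$ $(e\in\mathbb N)$, and identify bit strings with natural numbers through the length-lexicographic bijection. A *(prefix-free) machine* is a program $e$ such that the set of strings on which $\varphi_e$ halts is prefix-free; its halting probability is $\Omega_e=\sum_{\varphi_e(s)\downarrow}2^{-|s|}$. A machine $u$ is *universal* if for every machine $e$ there is a constant $c$ such that whenever $\varphi_e(s)=t$ there is $s'$ with $\varphi_u(s')=t$ and $|s'|\le|s|+c$. Let $\gamma_e\in[0,1]$ be the $e$-th c.e. real, i.e. the supremum of the rationals in $[0,1]$ listed by $\varphi_e$ (equivalently, the limit of the increasing computable sequence of the greatest rational listed so far; $0$ if none is listed); $(\gamma_e)_e$ is an effective enumeration of all c.e. reals in $[0,1]$, and $e$ is regarded as a representation of the real $\gamma_e$. Call an index $e$ *provably random* if Peano Arithmetic (PA), in the language $0,1,+,\cdot,<$, proves the arithmetical sentence "$\gamma_{e}\in(0,1)$" and proves the arithmetical sentence "$\gamma_{e}$ is random", in one of the two forms: (Chaitin) there are a universal machine $U$ and a constant $c$ such that for all $n\ge1$ every program $p$ with $U(p)=\gamma_e(n)$ has $|p|\ge n-c$, where $\gamma_e(n)$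 is the string of the first $n$ binary digits of $\gamma_e$; or (Solovay) $\gamma_e=2^{-c}\cdot\Omega_V+\gamma_k$ for some universal machine $V$, some $c\ge0$ and some $k$ with $\gamma_k>0$. Here the real $\gamma_e$ is presented to PA by the program $e$. **Theorem.** The set of provably random indices is computably enumerable: there is a primitive recursive enumeration $f$ (which is allowed to output nothing at some stages) whose outputs are exactly the provably random indices. There are computable functions $r$ that turn every machine $e$ into a representation $r(e)$ of its halting probability, i.e. $\gamma_{r(e)}=\Omega_e$ for every machine $e$; and for every such $r$ there is a universal machine $U_t$ (with program $t$) whose halting probability, as represented by $r(t)$, differs from all the $\gamma_{f(i)}$ as represented by $f(i)$: $r(t)\ne f(i)$ for all $i$. That is, based on $U_t$, PA cannot prove the randomness of $\Omega_{U_t}$. -/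

import Mathlib

namespace ProvRand

/-! ## First-order arithmetic: syntax

Terms and formulas of the language `0, 1, +, ·, <` with de Bruijn indices: `var i` refers to the
`i`-th innermost enclosing quantifier. -/

inductive Tm : Type
  | var (i : ℕ) : Tm
  | zero : Tm
  | one : Tm
  | add (t u : Tm) : Tm
  | mul (t u : Tm) : Tm

inductive Fml : Type
  | bot : Fml
  | eq (t u : Tm) : Fml
  | lt (t u : Tm) : Fml
  | imp (φ ψ : Fml) : Fml
  | all (φ : Fml) : Fml

instance : Zero Tm := ⟨Tm.zero⟩
instance : One Tm := ⟨Tm.one⟩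
instance : Add Tm := ⟨Tm.add⟩
instance : Mul Tm := ⟨Tm.mul⟩

/-- The closed term `(⋯((0 + 1) + 1) ⋯ + 1)` denoting `n`. -/
def num : ℕ → Tm
  | 0 => 0
  | n + 1 => num n + 1

/-- Raise by one all variables with index at least `k`. -/
def Tm.lift (k : ℕ) : Tm → Tm
  | var i => if i < k then var i else var (i + 1)
  | zero => zero
  | one => one
  | add t u => add (t.lift k) (u.lift k)
  | mul t u => mul (t.lift k) (u.lift k)

/-- Replace variable `k` by `s`, lowering by one the variables with larger index. -/
def Tm.subst (k : ℕ) (s : Tm) : Tm → Tm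
  | var i => if i < k then var i else if i = k then s else var (i - 1)
  | zero => zero
  | one => one
  | add t u => add (Tm.subst k s t) (Tm.subst k s u)
  | mul t u => mul (Tm.subst k s t) (Tm.subst k s u)

/-- The term `t`, read below `n` additional quantifiers. -/
def Tm.up (t : Tm) : ℕ → Tm
  | 0 => t
  | n + 1 => (t.up n).lift 0

namespace Fml

def lift (k : ℕ) : Fml → Fml
  | bot => bot
  | eq t u => eq (t.lift k) (u.lift k)
  | lt t u => lt (t.lift k) (u.lift k)
  | imp φ ψ => imp (φ.lift k) (ψ.lift k)
  | all φ => all (φ.lift (k + 1))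

/-- Capture-avoiding substitution of `s` for variable `k`. -/
def subst (k : ℕ) (s : Tm) : Fml → Fml
  | bot => bot
  | eq t u => eq (Tm.subst k s t) (Tm.subst k s u)
  | lt t u => lt (Tm.subst k s t) (Tm.subst k s u)
  | imp φ ψ => imp (φ.subst k s) (ψ.subst k s)
  | all φ => all (φ.subst (k + 1) (s.lift 0))

def neg (φ : Fml) : Fml := imp φ bot
def or (φ ψ : Fml) : Fml := imp (neg φ) ψ
def and (φ ψ : Fml) : Fml := neg (imp φ (neg ψ))
def iff (φ ψ : Fml) : Fml := and (imp φ ψ) (imp ψ φ)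
def ex (φ : Fml) : Fml := neg (all (neg φ))

/-- A block of `n` universal quantifiers; the outermost one binds `var (n - 1)`. -/
def alls : ℕ → Fml → Fml
  | 0, φ => φ
  | n + 1, φ => all (alls n φ)

/-- A block of `n` existential quantifiers; the outermost one binds `var (n - 1)`. -/
def exs : ℕ → Fml → Fml
  | 0, φ => φ
  | n + 1, φ => ex (exs n φ)

end Fml

open Fml

/-! ## Peano arithmetic and formal provability -/

/-- Derivability in classical first-order logic with equality (a Hilbert calculus) from the
universal closures of the formulas in `Ax`. -/
inductive Derivable (Ax : Fml → Prop) : Fml → Prop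
  | ax {φ : Fml} : Ax φ → Derivable Ax φ
  | k (φ ψ : Fml) : Derivable Ax (imp φ (imp ψ φ))
  | s (φ ψ χ : Fml) :
      Derivable Ax (imp (imp φ (imp ψ χ)) (imp (imp φ ψ) (imp φ χ)))
  | dne (φ : Fml) : Derivable Ax (imp (neg (neg φ)) φ)
  | inst (φ : Fml) (t : Tm) : Derivable Ax (imp (all φ) (φ.subst 0 t))
  | distrib (φ ψ : Fml) : Derivable Ax (imp (all (imp φ ψ)) (imp (all φ) (all ψ)))
  | vacuous (φ : Fml) : Derivable Ax (imp φ (all (φ.lift 0)))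
  | refl (t : Tm) : Derivable Ax (eq t t)
  | leibniz (φ : Fml) (t u : Tm) :
      Derivable Ax (imp (eq t u) (imp (φ.subst 0 t) (φ.subst 0 u)))
  | mp {φ ψ : Fml} : Derivable Ax (imp φ ψ) → Derivable Ax φ → Derivable Ax ψ
  | gen {φ : Fml} : Derivable Ax φ → Derivable Ax (all φ)

abbrev v (i : ℕ) : Tm := Tm.var i

/-- The axioms of Peano arithmetic: the theory of the non-negative parts of discretely ordered
rings, and induction for every formula `φ` in the variable `var 0` (with arbitrary further
variables as parameters). Free variables are understood as universally quantified. -/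
inductive PAAxiom : Fml → Prop
  | add_assoc : PAAxiom (eq ((v 0 + v 1) + v 2) (v 0 + (v 1 + v 2)))
  | add_comm : PAAxiom (eq (v 0 + v 1) (v 1 + v 0))
  | mul_assoc : PAAxiom (eq ((v 0 * v 1) * v 2) (v 0 * (v 1 * v 2)))
  | mul_comm : PAAxiom (eq (v 0 * v 1) (v 1 * v 0))
  | distrib : PAAxiom (eq (v 0 * (v 1 + v 2)) (v 0 * v 1 + v 0 * v 2))
  | zero : PAAxiom (and (eq (v 0 + 0) (v 0)) (eq (v 0 * 0) 0))
  | mul_one : PAAxiom (eq (v 0 * 1) (v 0))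
  | lt_trans : PAAxiom (imp (and (lt (v 0) (v 1)) (lt (v 1) (v 2))) (lt (v 0) (v 2)))
  | lt_irrefl : PAAxiom (neg (lt (v 0) (v 0)))
  | trichotomy : PAAxiom (or (lt (v 0) (v 1)) (or (eq (v 0) (v 1)) (lt (v 1) (v 0))))
  | add_lt : PAAxiom (imp (lt (v 0) (v 1)) (lt (v 0 + v 2) (v 1 + v 2)))
  | mul_lt :
      PAAxiom (imp (and (lt 0 (v 2)) (lt (v 0) (v 1))) (lt (v 0 * v 2) (v 1 * v 2)))
  | sub : PAAxiom (imp (lt (v 0) (v 1)) (ex (eq (v 1 + v 0) (v 2))))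
  | discrete : PAAxiom (and (lt 0 1) (imp (lt 0 (v 0)) (or (lt 1 (v 0)) (eq 1 (v 0)))))
  | nonneg : PAAxiom (or (lt 0 (v 0)) (eq 0 (v 0)))
  | induction (φ : Fml) :
      PAAxiom (imp (φ.subst 0 0)
        (imp (all (imp φ ((φ.lift 1).subst 0 (v 0 + 1)))) (all φ)))

/-- `PA ⊢ φ`. -/
def PAProves (φ : Fml) : Prop := Derivable PAAxiom φ

/-! ## Programs, machines, halting probabilities, c.e. reals -/

/-- The partial computable function with program number `e`. -/
def prog (e : ℕ) : ℕ →. ℕ := (Denumerable.ofNat Nat.Partrec.Code e).eval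

/-- The canonical (length-lexicographic) bijection from bit strings to natural numbers. -/
def strNum (s : List Bool) : ℕ := s.foldl (fun n b => 2 * n + 1 + b.toNat) 0

/-- Program `e`, acting on bit strings, outputs `t` on input `s`. -/
def Outputs (e : ℕ) (s t : List Bool) : Prop := strNum t ∈ prog e (strNum s)

/-- Program `e` halts on the bit string `s`. -/
def Halts (e : ℕ) (s : List Bool) : Prop := ∃ t, Outputs e s t

/-- Program `e` is a prefix-free machine. -/
def IsMachine (e : ℕ) : Prop := ∀ s s', Halts e s → Halts e s' → s <+: s' → s = s'

/-- Program `u` is a universal prefix-free machine. -/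
def IsUniversal (u : ℕ) : Prop :=
  IsMachine u ∧ ∀ e, IsMachine e → ∃ c : ℕ, ∀ s t, Outputs e s t →
    ∃ s', Outputs u s' t ∧ s'.length ≤ s.length + c

/-- The halting probability of the machine `e`. -/
noncomputable def Omega (e : ℕ) : ℝ := ∑' s : {s // Halts e s}, (1 / 2 : ℝ) ^ s.1.length

/-- Program `e` lists the rational `a / (b + 1)` of the unit interval. -/
def Lists (e a b : ℕ) : Prop := a ≤ b + 1 ∧ ∃ n, Nat.pair a b ∈ prog e n

/-- The `e`-th c.e. real of the unit interval: the supremum of the rationals of the unit interval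
that program `e` lists (`0` if there are none), i.e. the limit of the increasing sequence of the
greatest rational listed so far. -/
noncomputable def ceReal (e : ℕ) : ℝ := sSup {x : ℝ | ∃ a b, Lists e a b ∧ x = a / (b + 1)}

/-! ## The same notions as formulas of arithmetic

The arguments of each of the following formulas are terms; numbers stand for bit strings through
`strNum` and for programs through the numbering of `Nat.Partrec.Code`. -/

section Formulas

local infix:50 " ≐ " => Fml.eq
local infix:50 " ≺ " => Fml.lt
local prefix:max "∼" => Fml.neg
local infixr:35 " ⋏ " => Fml.and
local infixr:30 " ⋎ " => Fml.or
local infixr:25 " ⇒ " => Fml.imp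
local infixr:20 " ⇔ " => Fml.iff

/-- `t ≤ u` -/
def leF (t u : Tm) : Fml := ∼(u ≺ t)

/-- `c = Nat.pair a b` -/
def pairF (a b c : Tm) : Fml :=
  (a ≺ b ⋏ c ≐ b * b + a) ⋎ (leF b a ⋏ c ≐ a * a + a + b)

/-- `z` is the `i`-th entry of the sequence coded by `s` (Gödel's β-function). -/
def betaF (s i z : Tm) : Fml :=
  exs 3 (pairF (v 2) (v 1) (s.up 3) ⋏
    v 2 ≐ v 0 * ((i.up 3 + 1) * v 1 + 1) + z.up 3 ⋏
    z.up 3 ≺ (i.up 3 + 1) * v 1 + 1)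

/-- `y = 2 ^ k` -/
def powF (k y : Tm) : Fml :=
  ex (betaF (v 0) 0 1 ⋏ betaF (v 0) (k.up 1) (y.up 1) ⋏
    all (v 0 ≺ k.up 2 ⇒
      ex (betaF (v 2) (v 1) (v 0) ⋏ betaF (v 2) (v 1 + 1) (v 0 + v 0))))

/-- The triple `(c, x, y)` is the `j`-th entry of the sequence `s`. -/
def entryF (s j c x y : Tm) : Fml :=
  exs 2 (pairF (x.up 2) (y.up 2) (v 1) ⋏ pairF (c.up 2) (v 1) (v 0) ⋏
    betaF (s.up 2) (j.up 2) (v 0))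

/-- The triple `(c, x, y)` occurs in the sequence `s` before position `k`. -/
def beforeF (s k c x y : Tm) : Fml :=
  ex (v 0 ≺ k.up 1 ⋏ entryF (s.up 1) (v 0) (c.up 1) (x.up 1) (y.up 1))

/-- "Program `c` on input `x` outputs `y`" follows from one rule of computation applied to triples
that occur in `s` before position `k`. -/
def stepF (s k c x y : Tm) : Fml :=
  (c ≐ 0 ⋏ y ≐ 0) ⋎
  (c ≐ 1 ⋏ y ≐ x + 1) ⋎
  (c ≐ num 2 ⋏ ex (pairF (y.up 1) (v 0) (x.up 1))) ⋎
  (c ≐ num 3 ⋏ ex (pairF (v 0) (y.up 1) (x.up 1))) ⋎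
  -- pairing of `f = v 4`, `g = v 3`, with values `v 1`, `v 0`
  exs 5 (pairF (v 4) (v 3) (v 2) ⋏ c.up 5 ≐ num 4 * v 2 + num 4 ⋏
    pairF (v 1) (v 0) (y.up 5) ⋏
    beforeF (s.up 5) (k.up 5) (v 4) (x.up 5) (v 1) ⋏
    beforeF (s.up 5) (k.up 5) (v 3) (x.up 5) (v 0)) ⋎
  -- composition of `f = v 3` after `g = v 2`
  exs 4 (pairF (v 3) (v 2) (v 1) ⋏ c.up 4 ≐ num 4 * v 1 + num 6 ⋏
    beforeF (s.up 4) (k.up 4) (v 2) (x.up 4) (v 0) ⋏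
    beforeF (s.up 4) (k.up 4) (v 3) (v 0) (y.up 4)) ⋎
  -- primitive recursion from `f = v 3`, `g = v 2`, at `x = (a, 0)` with `a = v 0`
  exs 4 (pairF (v 3) (v 2) (v 1) ⋏ c.up 4 ≐ num 4 * v 1 + num 5 ⋏
    pairF (v 0) 0 (x.up 4) ⋏
    beforeF (s.up 4) (k.up 4) (v 3) (v 0) (y.up 4)) ⋎
  -- primitive recursion from `f = v 8`, `g = v 7`, at `x = (a, m + 1)` with `a = v 5`, `m = v 4`,
  -- where `v 3` is the value at `(a, m) = v 2` and `v 0 = (a, (m, v 3))`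
  exs 9 (pairF (v 8) (v 7) (v 6) ⋏ c.up 9 ≐ num 4 * v 6 + num 5 ⋏
    pairF (v 5) (v 4 + 1) (x.up 9) ⋏ pairF (v 5) (v 4) (v 2) ⋏
    beforeF (s.up 9) (k.up 9) (c.up 9) (v 2) (v 3) ⋏
    pairF (v 4) (v 3) (v 1) ⋏ pairF (v 5) (v 1) (v 0) ⋏
    beforeF (s.up 9) (k.up 9) (v 7) (v 0) (y.up 9)) ⋎
  -- unbounded search for a zero of `f = v 1`: found at `x = (v 0, y)`
  exs 2 (c.up 2 ≐ num 4 * v 1 + num 7 ⋏ pairF (v 0) (y.up 2) (x.up 2) ⋏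
    beforeF (s.up 2) (k.up 2) (v 1) (x.up 2) 0) ⋎
  -- unbounded search for a zero of `f = v 4`: not found at `x = (v 3, v 2)`, hence continued at
  -- `v 1 = (v 3, v 2 + 1)`
  exs 5 (c.up 5 ≐ num 4 * v 4 + num 7 ⋏ pairF (v 3) (v 2) (x.up 5) ⋏
    beforeF (s.up 5) (k.up 5) (v 4) (x.up 5) (v 0 + 1) ⋏
    pairF (v 3) (v 2 + 1) (v 1) ⋏
    beforeF (s.up 5) (k.up 5) (c.up 5) (v 1) (y.up 5))

/-- Program `e` outputs `y` on input `x`: some finite sequence of triples, each obtained by a rule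
of computation from earlier ones, contains `(e, x, y)`. -/
def progF (e x y : Tm) : Fml :=
  exs 2 (beforeF (v 1) (v 0) (e.up 2) (x.up 2) (y.up 2) ⋏
    all (v 0 ≺ v 1 ⇒
      exs 3 (entryF (v 5) (v 3) (v 2) (v 1) (v 0) ⋏
        stepF (v 5) (v 3) (v 2) (v 1) (v 0))))

/-- Program `e` halts on `x`. -/
def haltsF (e x : Tm) : Fml := ex (progF (e.up 1) (x.up 1) (v 0))

/-- The string `s` has length `l`, and `p = 2 ^ l`. -/
def lenPowF (s l p : Tm) : Fml := powF l p ⋏ leF p (s + 1) ⋏ s + 1 ≺ p + p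

/-- The string `s` has length `l`. -/
def lenF (s l : Tm) : Fml := ex (lenPowF (s.up 1) (l.up 1) (v 0))

/-- The string `s` is a prefix of the string `t`. -/
def prefixF (s t : Tm) : Fml :=
  exs 3 (powF (v 2) (v 1) ⋏ t.up 3 + 1 ≐ (s.up 3 + 1) * v 1 + v 0 ⋏ v 0 ≺ v 1)

/-- Program `e` is a prefix-free machine. -/
def machineF (e : Tm) : Fml :=
  alls 2 (haltsF (e.up 2) (v 1) ⇒ haltsF (e.up 2) (v 0) ⇒ prefixF (v 1) (v 0) ⇒ v 1 ≐ v 0)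

/-- Program `u` is a universal prefix-free machine. -/
def universalF (u : Tm) : Fml :=
  machineF u ⋏
  all (machineF (v 0) ⇒
    -- `v 3` is the other machine, `v 2` the constant, `v 1` and `v 0` its input and output
    ex (alls 2 (progF (v 3) (v 1) (v 0) ⇒
      -- `v 2` is the new input, of length `v 0`; the old one has length `v 1`
      exs 3 (progF (u.up 7) (v 2) (v 3) ⋏ lenF (v 4) (v 1) ⋏ lenF (v 2) (v 0) ⋏
        leF (v 0) (v 1 + v 5)))))

/-- Program `e` lists the rational `a / (b + 1)` of the unit interval. -/
def listsF (e a b : Tm) : Fml :=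
  leF a (b + 1) ⋏
  exs 2 (pairF (a.up 2) (b.up 2) (v 0) ⋏ progF (e.up 2) (v 1) (v 0))

/-- The `e`-th c.e. real exceeds `p / q` (for `q > 0`). -/
def aboveF (e p q : Tm) : Fml :=
  exs 2 (listsF (e.up 2) (v 1) (v 0) ⋏ p.up 2 * (v 0 + 1) ≺ v 1 * q.up 2)

/-- The `e`-th c.e. real is less than `p / q` (for `q > 0`): it does not exceed some rational
below `p / q`. -/
def belowF (e p q : Tm) : Fml :=
  exs 2 (0 ≺ v 0 ⋏ v 1 * q.up 2 ≺ p.up 2 * v 0 ⋏ ∼(aboveF (e.up 2) (v 1) (v 0)))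

/-- The `e`-th c.e. real lies in the open interval `(0, 1)`. -/
def unitF (e : Tm) : Fml := aboveF e 0 1 ⋏ belowF e 1 1

/-- The string `s` consists of the first `n` binary digits of the `e`-th c.e. real `γ`: with
`p = 2 ^ n = v 1` and `s + 1 = p + m`, `m = v 0 < p`, one has `m / p ≤ γ < (m + 1) / p`. -/
def digitsF (e n s : Tm) : Fml :=
  exs 2 (powF (n.up 2) (v 1) ⋏ s.up 2 + 1 ≐ v 1 + v 0 ⋏ v 0 ≺ v 1 ⋏
    ∼(belowF (e.up 2) (v 0) (v 1)) ⋏ belowF (e.up 2) (v 0 + 1) (v 1))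

/-- The `e`-th c.e. real `γ` is Chaitin-random: there are a universal machine `U = v 1` and a
constant `c = v 0` such that `H_U(γ(n)) ≥ n - c` for all `n ≥ 1`. -/
def chaitinF (e : Tm) : Fml :=
  exs 2 (universalF (v 1) ⋏
    all (0 ≺ v 0 ⇒
      -- `n = v 1`, `γ(n) = v 0`
      ex (digitsF (e.up 4) (v 1) (v 0) ⋏
        all (progF (v 4) (v 0) (v 1) ⇒
          ex (lenF (v 1) (v 0) ⋏ leF (v 3) (v 0 + v 4))))))

/-- The sum of `2 ^ (-|x|)` over some finite set of strings `x` on which program `e` halts equals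
`p / 2 ^ n`. The strings are the first `L = v 1` entries of the strictly increasing sequence
`v 3`, the numerators of the partial sums form the sequence `v 2`, and `v 0 = 2 ^ n`. -/
def partialSumF (e p n : Tm) : Fml :=
  exs 4 (powF (n.up 4) (v 0) ⋏ betaF (v 2) 0 0 ⋏ betaF (v 2) (v 1) (p.up 4) ⋏
    all (v 0 ≺ v 2 ⇒
      -- at stage `j = v 6`: string `v 5`, next string `v 4`, partial sum `v 3`, length `v 2`,
      -- `v 1 = 2 ^ length`, summand `v 0`
      exs 6 (betaF (v 10) (v 6) (v 5) ⋏ betaF (v 10) (v 6 + 1) (v 4) ⋏ v 5 ≺ v 4 ⋏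
        haltsF (e.up 11) (v 5) ⋏ lenPowF (v 5) (v 2) (v 1) ⋏ v 1 * v 0 ≐ v 7 ⋏
        betaF (v 9) (v 6) (v 3) ⋏ betaF (v 9) (v 6 + 1) (v 3 + v 0))))

/-- `γ_e = 2 ^ (-c) * Ω_u + γ_k`, where `γ_k > 0`: a rational `p / q` is exceeded by `γ_e` if and
only if it is exceeded by `2 ^ (-c) * (P / 2 ^ N) + a / (b + 1)` for some partial sum `P / 2 ^ N`
of `Ω_u` and some rational `a / (b + 1)` listed by `k`. -/
def solovaySumF (e c u k : Tm) : Fml :=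
  alls 2 (0 ≺ v 0 ⇒
    (aboveF (e.up 2) (v 1) (v 0) ⇔
      -- `p = v 6`, `q = v 5`, `P = v 4`, `N = v 3`, `a = v 2`, `b = v 1`, `2 ^ (N + c) = v 0`
      exs 5 (partialSumF (u.up 7) (v 4) (v 3) ⋏ listsF (k.up 7) (v 2) (v 1) ⋏
        powF (v 3 + c.up 7) (v 0) ⋏
        v 6 * (v 0 * (v 1 + 1)) ≺ v 5 * (v 4 * (v 1 + 1) + v 2 * v 0))))

/-- The `e`-th c.e. real has the form `2 ^ (-c) * Ω_V + γ` with `V` a universal machine and `γ` a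
positive c.e. real. -/
def solovayF (e : Tm) : Fml :=
  exs 3 (universalF (v 1) ⋏ aboveF (v 0) 0 1 ⋏ solovaySumF (e.up 3) (v 2) (v 1) (v 0))

end Formulas

/-- PA proves, of the `e`-th c.e. real as given by program `e`, that it lies in `(0, 1)` and that
it is random: either that it is Chaitin-random or that it has the form `2 ^ (-c) * Ω_V + γ` above.
(The existential quantifiers over `V`, `c`, `γ` are inside the sentence, so a proof for particular
`V`, `c`, `γ` is a special case.) -/
def ProvablyRandom (e : ℕ) : Prop :=
  PAProves ((unitF (v 0)).subst 0 (num e)) ∧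
    (PAProves ((chaitinF (v 0)).subst 0 (num e)) ∨ PAProves ((solovayF (v 0)).subst 0 (num e)))

/-- `r` effectively turns every prefix-free machine into a representation, as a c.e. real, of its
halting probability. -/
def RepresentsOmega (r : ℕ → ℕ) : Prop :=
  Computable r ∧ ∀ e, IsMachine e → ceReal (r e) = Omega e

end ProvRand

namespace ProvRand
open Fml

/-! ## The standard model -/

/-! The provably random indices form a c.e. set because proofs can be enumerated. A universal
machine can therefore watch the enumeration `f` for a representation of its own halting probability
and spoil that probability if the representation appears.

By the recursion theorem there is a program `t` that knows `r t`. It simulates a fixed universal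
machine until `f` outputs `r t`. If this first happens at stage `k`, only finitely many strings have
been seen to halt, all shorter than `k`. The program then halts also on every string of length `k`
that extends none of them, and on nothing else. The resulting domain is a finite maximal prefix-free
set, so its halting probability is `1` by the equality case of Kraft's inequality
(`Omega_spoiled_eq_one`), and `ceReal (r t) = 1`. But PA would have proved that this real lies in
`(0, 1)`, and PA is sound (`PAProves.sat`), a contradiction (`not_provablyRandom_of_ceReal_eq_one`).
Hence `f` never outputs `r t`, the spoiling never starts, and `t` computes the same function as the
universal machine (`exists_universal_not_enumerated`).

Soundness is used only for the sentence "`γ` lies in `(0, 1)`"; the meaning of the two randomness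
sentences plays no role. In "`γ < 1`" computations occur only negatively, so it suffices that true
computations satisfy the formula `progF` (`sat_progF_of_mem`).

For the enumeration, PA-provability, together with lifting and substitution on codes, is described
by finitely many Horn clauses over pairing and successor. Any set generated in this way has sections
with a primitive recursive enumeration (`exists_primrec_enum_horn`), and `horn_iff_provablyRandom`
says that the clauses are sound and complete. -/

/-- Insert the value `a` at position `k` of an assignment. -/
def insertAt (k a : ℕ) (ρ : ℕ → ℕ) (i : ℕ) : ℕ :=
  if i < k then ρ i else if i = k then a else ρ (i - 1)

@[simp] theorem insertAt_zero_zero (a : ℕ) (ρ : ℕ → ℕ) : insertAt 0 a ρ 0 = a := by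
  simp [insertAt]

@[simp] theorem insertAt_zero_succ (a i : ℕ) (ρ : ℕ → ℕ) : insertAt 0 a ρ (i + 1) = ρ i := by
  simp [insertAt]

/-- This commutation carries the inductions on formulas through a quantifier: the bound variable
takes position 0 and position `k` becomes `k + 1`. -/
theorem insertAt_succ (k a b : ℕ) (ρ : ℕ → ℕ) :
    insertAt (k + 1) b (insertAt 0 a ρ) = insertAt 0 a (insertAt k b ρ) := by
  funext i
  cases i with
  | zero => simp [insertAt]
  | succ i =>
    rw [insertAt_zero_succ]
    by_cases h1 : i < k
    · simp [insertAt, h1]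
    · by_cases h2 : i = k
      · simp [insertAt, h2]
      · have : i ≠ 0 := by omega
        simp [insertAt, h1, h2, this]

/-- The value of a term in the standard model. -/
def Tm.val (ρ : ℕ → ℕ) : Tm → ℕ
  | var i => ρ i
  | zero => 0
  | one => 1
  | add t u => t.val ρ + u.val ρ
  | mul t u => t.val ρ * u.val ρ

/-- Truth in the standard model. -/
def Fml.Sat : (ℕ → ℕ) → Fml → Prop
  | _, bot => False
  | ρ, eq t u => t.val ρ = u.val ρ
  | ρ, lt t u => t.val ρ < u.val ρ
  | ρ, imp φ ψ => φ.Sat ρ → ψ.Sat ρ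
  | ρ, all φ => ∀ a, φ.Sat (insertAt 0 a ρ)

section Val
variable (ρ : ℕ → ℕ)

@[simp] theorem val_var (i : ℕ) : (Tm.var i).val ρ = ρ i := rfl
@[simp] theorem val_zero : (0 : Tm).val ρ = 0 := rfl
@[simp] theorem val_one : (1 : Tm).val ρ = 1 := rfl
@[simp] theorem val_add (t u : Tm) : (t + u).val ρ = t.val ρ + u.val ρ := rfl
@[simp] theorem val_mul (t u : Tm) : (t * u).val ρ = t.val ρ * u.val ρ := rfl

@[simp] theorem val_num (n : ℕ) : (num n).val ρ = n := by
  induction n with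
  | zero => rfl
  | succ n ih => simp [num, ih]

theorem val_lift (k a : ℕ) (t : Tm) : (t.lift k).val (insertAt k a ρ) = t.val ρ := by
  induction t with
  | var i =>
    by_cases h : i < k
    · simp [Tm.lift, h, insertAt]
    · have h1 : ¬ i + 1 < k := by omega
      have h2 : i + 1 ≠ k := by omega
      simp [Tm.lift, h, insertAt, h1, h2]
  | zero => rfl
  | one => rfl
  | add t u iht ihu => simp [Tm.lift, Tm.val, iht, ihu]
  | mul t u iht ihu => simp [Tm.lift, Tm.val, iht, ihu]

@[simp] theorem val_up_zero (t : Tm) : (t.up 0).val ρ = t.val ρ := rfl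

@[simp] theorem val_up_succ (t : Tm) (n a : ℕ) :
    (t.up (n + 1)).val (insertAt 0 a ρ) = (t.up n).val ρ := val_lift ρ 0 a _

theorem val_subst (k : ℕ) (s t : Tm) :
    (Tm.subst k s t).val ρ = t.val (insertAt k (s.val ρ) ρ) := by
  induction t with
  | var i =>
    by_cases h : i < k
    · simp [Tm.subst, h, insertAt]
    · by_cases h' : i = k
      · simp [Tm.subst, h', insertAt]
      · simp [Tm.subst, h, h', insertAt]
  | zero => rfl
  | one => rfl
  | add t u iht ihu => simp [Tm.subst, Tm.val, iht, ihu]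
  | mul t u iht ihu => simp [Tm.subst, Tm.val, iht, ihu]

end Val

section Sat
variable (ρ : ℕ → ℕ)

@[simp] theorem sat_bot : Sat ρ bot ↔ False := Iff.rfl
@[simp] theorem sat_eq (t u : Tm) : Sat ρ (eq t u) ↔ t.val ρ = u.val ρ := Iff.rfl
@[simp] theorem sat_lt (t u : Tm) : Sat ρ (lt t u) ↔ t.val ρ < u.val ρ := Iff.rfl
@[simp] theorem sat_imp (φ ψ : Fml) : Sat ρ (imp φ ψ) ↔ (φ.Sat ρ → ψ.Sat ρ) := Iff.rfl
@[simp] theorem sat_all (φ : Fml) : Sat ρ (all φ) ↔ ∀ a, φ.Sat (insertAt 0 a ρ) := Iff.rfl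
@[simp] theorem sat_neg (φ : Fml) : Sat ρ (neg φ) ↔ ¬ φ.Sat ρ := Iff.rfl
@[simp] theorem sat_or (φ ψ : Fml) : Sat ρ (or φ ψ) ↔ φ.Sat ρ ∨ ψ.Sat ρ := by
  simp [Fml.or, or_iff_not_imp_left]
@[simp] theorem sat_and (φ ψ : Fml) : Sat ρ (and φ ψ) ↔ φ.Sat ρ ∧ ψ.Sat ρ := by
  simp [Fml.and]
@[simp] theorem sat_ex (φ : Fml) : Sat ρ (ex φ) ↔ ∃ a, φ.Sat (insertAt 0 a ρ) := by
  simp [Fml.ex]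
@[simp] theorem sat_exs_zero (φ : Fml) : Sat ρ (exs 0 φ) ↔ φ.Sat ρ := Iff.rfl
@[simp] theorem sat_exs_succ (n : ℕ) (φ : Fml) :
    Sat ρ (exs (n + 1) φ) ↔ ∃ a, (exs n φ).Sat (insertAt 0 a ρ) := sat_ex ρ _

end Sat

theorem sat_lift (φ : Fml) (k a : ℕ) (ρ : ℕ → ℕ) :
    (φ.lift k).Sat (insertAt k a ρ) ↔ φ.Sat ρ := by
  induction φ generalizing k ρ with
  | bot => rfl
  | eq t u => simp [Fml.lift, val_lift]
  | lt t u => simp [Fml.lift, val_lift]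
  | imp φ ψ ihφ ihψ => simp [Fml.lift, ihφ, ihψ]
  | all φ ih => simp [Fml.lift, ← insertAt_succ, ih]

theorem sat_subst (φ : Fml) (k : ℕ) (s : Tm) (ρ : ℕ → ℕ) :
    (φ.subst k s).Sat ρ ↔ φ.Sat (insertAt k (s.val ρ) ρ) := by
  induction φ generalizing k s ρ with
  | bot => rfl
  | eq t u => simp [Fml.subst, val_subst]
  | lt t u => simp [Fml.subst, val_subst]
  | imp φ ψ ihφ ihψ => simp [Fml.subst, ihφ, ihψ]
  | all φ ih => simp [Fml.subst, ih, val_lift, insertAt_succ]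

theorem sat_of_paAxiom {φ : Fml} (h : PAAxiom φ) (ρ : ℕ → ℕ) : φ.Sat ρ := by
  cases h with
  | induction φ =>
    simp only [sat_imp, sat_all, sat_subst, val_zero, val_add, val_one, val_var,
      insertAt_zero_zero]
    intro h0 hs n
    induction n with
    | zero => exact h0
    | succ n ih =>
      have := hs n ih
      -- In the induction axiom `φ.lift 1` skips position 1, where the old value `n` sits after `n +
      -- 1` has been put at position 0; so `n` drops out.
      rwa [← insertAt_succ, sat_lift] at this
  | lt_trans => simpa using fun h h' => lt_trans h h'
  | trichotomy => simpa using lt_trichotomy _ _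
  | mul_lt => simpa using fun h h' => Nat.mul_lt_mul_of_pos_right h' h
  | sub => simpa using fun h => ⟨ρ 1 - ρ 0, by omega⟩
  | discrete => simp; omega
  | nonneg => simp; omega
  | _ => simp [add_assoc, add_comm, mul_assoc, mul_comm, mul_add]

/-- Peano arithmetic is sound for the standard model. -/
theorem PAProves.sat {φ : Fml} (h : PAProves φ) (ρ : ℕ → ℕ) : φ.Sat ρ := by
  induction h generalizing ρ with
  | ax h => exact sat_of_paAxiom h ρ
  | k φ ψ => exact fun h _ => h
  | s φ ψ χ => exact fun h h' h'' => h h'' (h' h'')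
  | dne φ => exact fun h => not_not.1 h
  | inst φ t => exact fun h => (sat_subst ..).2 (h _)
  | distrib φ ψ => exact fun h h' a => h a (h' a)
  | vacuous φ => exact fun h a => (sat_lift ..).2 h
  | refl t => rfl
  | leibniz φ t u =>
    intro h h'
    rw [sat_eq] at h
    rw [sat_subst] at h' ⊢
    rwa [← h]
  | mp _ _ ih ih' => exact ih ρ (ih' ρ)
  | gen _ ih => exact fun a => ih _

/-! ## Arithmetized computations -/

@[simp] theorem sat_leF (ρ : ℕ → ℕ) (t u : Tm) : Sat ρ (leF t u) ↔ t.val ρ ≤ u.val ρ := by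
  simp [leF]

@[simp] theorem sat_pairF (ρ : ℕ → ℕ) (a b c : Tm) :
    Sat ρ (pairF a b c) ↔ c.val ρ = Nat.pair (a.val ρ) (b.val ρ) := by
  by_cases h : a.val ρ < b.val ρ
  · simp [pairF, Nat.pair, h]
  · simp [pairF, Nat.pair, h, not_lt.1 h]

/-- Division with remainder, with the quotient as a witness; this is the shape of `betaF`. -/
theorem beta_eq_iff (s i z : ℕ) :
    Nat.beta s i = z ↔ ∃ a b q, s = Nat.pair a b ∧ a = q * ((i + 1) * b + 1) + z ∧
      z < (i + 1) * b + 1 := by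
  constructor
  · rintro rfl
    refine ⟨s.unpair.1, s.unpair.2, s.unpair.1 / ((i + 1) * s.unpair.2 + 1), by simp, ?_,
      Nat.mod_lt _ (Nat.succ_pos _)⟩
    rw [Nat.beta, Nat.div_add_mod']
  · rintro ⟨a, b, q, rfl, rfl, h⟩
    simp [Nat.beta, Nat.mod_eq_of_lt h]

@[simp] theorem sat_betaF (ρ : ℕ → ℕ) (s i z : Tm) :
    Sat ρ (betaF s i z) ↔ Nat.beta (s.val ρ) (i.val ρ) = z.val ρ := by
  simp [betaF, beta_eq_iff]

@[simp] theorem sat_entryF (ρ : ℕ → ℕ) (s j c x y : Tm) :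
    Sat ρ (entryF s j c x y) ↔
      Nat.beta (s.val ρ) (j.val ρ) = Nat.pair (c.val ρ) (Nat.pair (x.val ρ) (y.val ρ)) := by
  simp [entryF]

@[simp] theorem sat_beforeF (ρ : ℕ → ℕ) (s k c x y : Tm) :
    Sat ρ (beforeF s k c x y) ↔ ∃ j < k.val ρ,
      Nat.beta (s.val ρ) j = Nat.pair (c.val ρ) (Nat.pair (x.val ρ) (y.val ρ)) := by
  simp [beforeF]

/-- One application of a rule of computation to triples (program, input, output) in `P`. -/
inductive Step (P : ℕ → ℕ → ℕ → Prop) : ℕ → ℕ → ℕ → Prop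
  | zero (x : ℕ) : Step P 0 x 0
  | succ (x : ℕ) : Step P 1 x (x + 1)
  | left (a b : ℕ) : Step P 2 (Nat.pair a b) a
  | right (a b : ℕ) : Step P 3 (Nat.pair a b) b
  | pair {f g x a b : ℕ} : P f x a → P g x b → Step P (4 * Nat.pair f g + 4) x (Nat.pair a b)
  | comp {f g x z y : ℕ} : P g x z → P f z y → Step P (4 * Nat.pair f g + 6) x y
  | precZero {f g a y : ℕ} : P f a y → Step P (4 * Nat.pair f g + 5) (Nat.pair a 0) y
  | precSucc {f g a m i y : ℕ} : P (4 * Nat.pair f g + 5) (Nat.pair a m) i →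
      P g (Nat.pair a (Nat.pair m i)) y → Step P (4 * Nat.pair f g + 5) (Nat.pair a (m + 1)) y
  | found {f a y : ℕ} : P f (Nat.pair a y) 0 → Step P (4 * f + 7) (Nat.pair a y) y
  | next {f a m n y : ℕ} : P f (Nat.pair a m) (n + 1) →
      P (4 * f + 7) (Nat.pair a (m + 1)) y → Step P (4 * f + 7) (Nat.pair a m) y

theorem Step.mono {P Q : ℕ → ℕ → ℕ → Prop} (h : ∀ c x y, P c x y → Q c x y) {c x y : ℕ}
    (hs : Step P c x y) : Step Q c x y := by
  cases hs with
  | zero => exact .zero _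
  | succ => exact .succ _
  | left => exact .left _ _
  | right => exact .right _ _
  | pair h₁ h₂ => exact .pair (h _ _ _ h₁) (h _ _ _ h₂)
  | comp h₁ h₂ => exact .comp (h _ _ _ h₁) (h _ _ _ h₂)
  | precZero h₁ => exact .precZero (h _ _ _ h₁)
  | precSucc h₁ h₂ => exact .precSucc (h _ _ _ h₁) (h _ _ _ h₂)
  | found h₁ => exact .found (h _ _ _ h₁)
  | next h₁ h₂ => exact .next (h _ _ _ h₁) (h _ _ _ h₂)

/-- Each rule of `Step` supplies the witnesses for one disjunct of `stepF`. The converse is not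
needed for soundness of "`γ < 1`". -/
theorem sat_stepF_of_step {ρ : ℕ → ℕ} {s k c x y : Tm}
    (h : Step (fun c x y => ∃ j < k.val ρ, Nat.beta (s.val ρ) j = Nat.pair c (Nat.pair x y))
      (c.val ρ) (x.val ρ) (y.val ρ)) : Sat ρ (stepF s k c x y) := by
  -- Case analysis on `Step` needs free indices in place of the values of terms.
  generalize hc : c.val ρ = c' at h
  generalize hx : x.val ρ = x' at h
  generalize hy : y.val ρ = y' at h
  simp only [stepF, sat_or]
  cases h with
  | zero => left; simp [hc, hy]
  | succ => right; left; simp [hc, hx, hy]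
  | left a b => right; right; left; simp [hc, hx, hy]
  | right a b => right; right; right; left; simp [hc, hx, hy]
  | @pair f g _ a b h₁ h₂ =>
    iterate 4 right
    left
    simp only [sat_exs_succ, sat_exs_zero]
    exact ⟨f, g, Nat.pair f g, a, b, by simpa [hc, hx, hy] using ⟨h₁, h₂⟩⟩
  | @comp f g _ z _ h₁ h₂ =>
    iterate 5 right
    left
    simp only [sat_exs_succ, sat_exs_zero]
    exact ⟨f, g, Nat.pair f g, z, by simpa [hc, hx, hy] using ⟨h₁, h₂⟩⟩
  | @precZero f g a _ h₁ =>
    iterate 6 right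
    left
    simp only [sat_exs_succ, sat_exs_zero]
    exact ⟨f, g, Nat.pair f g, a, by simpa [hc, hx, hy] using h₁⟩
  | @precSucc f g a m i _ h₁ h₂ =>
    iterate 7 right
    left
    simp only [sat_exs_succ, sat_exs_zero]
    exact ⟨f, g, Nat.pair f g, a, m, i, Nat.pair a m, Nat.pair m i, Nat.pair a (Nat.pair m i),
      by simpa [hc, hx, hy] using ⟨h₁, h₂⟩⟩
  | @found f a _ h₁ =>
    iterate 8 right
    left
    simp only [sat_exs_succ, sat_exs_zero]
    exact ⟨f, a, by simpa [hc, hx, hy] using h₁⟩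
  | @next f a m n _ h₁ h₂ =>
    iterate 9 right
    simp only [sat_exs_succ, sat_exs_zero]
    exact ⟨f, a, m, Nat.pair a (m + 1), n, by simpa [hc, hx, hy] using ⟨h₁, h₂⟩⟩

/-- A sequence of coded triples, each obtained by a rule of computation from earlier ones. -/
def IsComputation (L : List ℕ) : Prop :=
  ∀ k (h : k < L.length), ∃ c x y, L[k] = Nat.pair c (Nat.pair x y) ∧
    Step (fun c x y => Nat.pair c (Nat.pair x y) ∈ L.take k) c x y

/-- Rules ask only that premises occur earlier, so extra entries do no harm. Concatenation gathers
the premises of a two-premise rule in one computation. -/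
theorem IsComputation.append {L M : List ℕ} (hL : IsComputation L) (hM : IsComputation M) :
    IsComputation (L ++ M) := by
  intro k hk
  by_cases h : k < L.length
  · obtain ⟨c, x, y, h₁, h₂⟩ := hL k h
    refine ⟨c, x, y, by rw [List.getElem_append_left h, h₁], h₂.mono fun c x y h' => ?_⟩
    rw [List.take_append]
    exact List.mem_append_left _ h'
  · have hk' : k - L.length < M.length := by simp at hk; omega
    obtain ⟨c, x, y, h₁, h₂⟩ := hM _ hk'
    refine ⟨c, x, y, by rw [List.getElem_append_right (not_lt.1 h), h₁],
      h₂.mono fun c x y h' => ?_⟩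
    rw [List.take_append]
    exact List.mem_append_right _ h'

theorem IsComputation.concat {L : List ℕ} (hL : IsComputation L) {c x y : ℕ}
    (h : Step (fun c x y => Nat.pair c (Nat.pair x y) ∈ L) c x y) :
    IsComputation (L ++ [Nat.pair c (Nat.pair x y)]) := by
  intro k hk
  by_cases h' : k < L.length
  · obtain ⟨c, x, y, h₁, h₂⟩ := hL k h'
    refine ⟨c, x, y, by rw [List.getElem_append_left h', h₁], h₂.mono fun c x y h'' => ?_⟩
    rw [List.take_append]
    exact List.mem_append_left _ h''
  · obtain rfl : k = L.length := by simp at hk; omega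
    exact ⟨c, x, y, by simp, by simpa using h⟩

/-- Some computation contains the triple `(c, x, y)`. -/
def Computes (c x y : ℕ) : Prop := ∃ L, IsComputation L ∧ Nat.pair c (Nat.pair x y) ∈ L

theorem Computes.of_list {L : List ℕ} (hL : IsComputation L) {c x y : ℕ}
    (h : Step (fun c x y => Nat.pair c (Nat.pair x y) ∈ L) c x y) : Computes c x y :=
  ⟨_, hL.concat h, by simp⟩

theorem Computes.of_step {c x y : ℕ} (h : Step Computes c x y) : Computes c x y := by
  have h₀ : IsComputation [] := fun k hk => by simp at hk
  have two : ∀ {c x y c' x' y'}, Computes c x y → Computes c' x' y' → ∃ L, IsComputation L ∧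
      Nat.pair c (Nat.pair x y) ∈ L ∧ Nat.pair c' (Nat.pair x' y') ∈ L := by
    rintro c x y c' x' y' ⟨L, hL, h⟩ ⟨M, hM, h'⟩
    exact ⟨L ++ M, hL.append hM, List.mem_append_left _ h, List.mem_append_right _ h'⟩
  cases h with
  | zero => exact .of_list h₀ (.zero _)
  | succ => exact .of_list h₀ (.succ _)
  | left => exact .of_list h₀ (.left _ _)
  | right => exact .of_list h₀ (.right _ _)
  | pair h₁ h₂ => obtain ⟨L, hL, h, h'⟩ := two h₁ h₂; exact .of_list hL (.pair h h')
  | comp h₁ h₂ => obtain ⟨L, hL, h, h'⟩ := two h₁ h₂; exact .of_list hL (.comp h h')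
  | precZero h₁ => obtain ⟨L, hL, h⟩ := h₁; exact .of_list hL (.precZero h)
  | precSucc h₁ h₂ => obtain ⟨L, hL, h, h'⟩ := two h₁ h₂; exact .of_list hL (.precSucc h h')
  | found h₁ => obtain ⟨L, hL, h⟩ := h₁; exact .of_list hL (.found h)
  | next h₁ h₂ => obtain ⟨L, hL, h, h'⟩ := two h₁ h₂; exact .of_list hL (.next h h')

open Nat.Partrec (Code)

/-- Structural induction on the code. The constants `4 * _ + 4`, ..., `4 * _ + 7` in `Step` are
those of `Code.encodeCode`, up to rearrangement. -/
theorem computes_of_mem_eval (c : Code) {x y : ℕ} (h : y ∈ c.eval x) :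
    Computes (Encodable.encode c) x y := by
  rw [Code.encodeCode_eq]
  induction c generalizing x y with
  | zero =>
    obtain rfl : y = 0 := by simpa [Code.eval, pure, PFun.pure] using h
    exact .of_step (.zero _)
  | succ =>
    obtain rfl : y = x + 1 := by simpa [Code.eval] using h
    exact .of_step (.succ _)
  | left =>
    obtain rfl : y = x.unpair.1 := by simpa [Code.eval] using h
    have := Step.left (P := Computes) x.unpair.1 x.unpair.2
    rw [Nat.pair_unpair] at this
    exact .of_step this
  | right =>
    obtain rfl : y = x.unpair.2 := by simpa [Code.eval] using h
    have := Step.right (P := Computes) x.unpair.1 x.unpair.2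
    rw [Nat.pair_unpair] at this
    exact .of_step this
  | pair f g ihf ihg =>
    obtain ⟨a, ha, b, hb, rfl⟩ : ∃ a ∈ f.eval x, ∃ b ∈ g.eval x, Nat.pair a b = y := by
      simpa [Code.eval, Seq.seq] using h
    have := Computes.of_step (.pair (ihf ha) (ihg hb))
    rwa [show 4 * Nat.pair f.encodeCode g.encodeCode + 4 = (f.pair g).encodeCode by
      simp only [Code.encodeCode]; ring] at this
  | comp f g ihf ihg =>
    obtain ⟨z, hz, hy⟩ : ∃ z ∈ g.eval x, y ∈ f.eval z := Part.mem_bind_iff.1 h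
    have := Computes.of_step (.comp (ihg hz) (ihf hy))
    rwa [show 4 * Nat.pair f.encodeCode g.encodeCode + 6 = (f.comp g).encodeCode by
      simp only [Code.encodeCode]; ring] at this
  | prec f g ihf ihg =>
    rw [show (f.prec g).encodeCode = 4 * Nat.pair f.encodeCode g.encodeCode + 5 by
      simp only [Code.encodeCode]; ring]
    rw [← Nat.pair_unpair x] at h ⊢
    generalize x.unpair.1 = a at h ⊢
    generalize x.unpair.2 = m at h ⊢
    induction m generalizing y with
    | zero =>
      rw [Code.eval_prec_zero] at h
      exact .of_step (.precZero (ihf h))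
    | succ m ih =>
      obtain ⟨i, hi, hy⟩ : ∃ i ∈ (f.prec g).eval (Nat.pair a m),
          y ∈ g.eval (Nat.pair a (Nat.pair m i)) := by
        simpa [Code.eval_prec_succ] using h
      exact .of_step (.precSucc (ih hi) (ihg hy))
  | rfind' f ih =>
    rw [show f.rfind'.encodeCode = 4 * f.encodeCode + 7 by
      simp only [Code.encodeCode]; ring]
    rw [← Nat.pair_unpair x] at h ⊢
    generalize x.unpair.1 = a at h ⊢
    generalize x.unpair.2 = m at h ⊢
    -- The search that starts at `m` succeeds after `n` further steps. The induction on `n` below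
    -- generalizes `m`, because rule `next` advances the starting point.
    obtain ⟨n, ⟨h₀, h₁⟩, rfl⟩ : ∃ n, (0 ∈ f.eval (Nat.pair a (n + m)) ∧
        ∀ j < n, ∃ w ∈ f.eval (Nat.pair a (j + m)), w ≠ 0) ∧ n + m = y := by
      obtain ⟨n, hn, rfl⟩ : ∃ n ∈ Nat.rfind fun n =>
          (f.eval (Nat.pair a (n + m))).map (fun w => decide (w = 0)), n + m = y := by
        simpa [Code.eval] using h
      obtain ⟨h₀, h₁⟩ := Nat.mem_rfind.1 hn
      exact ⟨n, ⟨by simpa using h₀, fun j hj => by simpa using h₁ hj⟩, rfl⟩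
    clear h
    induction n generalizing m with
    | zero =>
      rw [Nat.zero_add] at h₀ ⊢
      exact .of_step (.found (ih h₀))
    | succ n ihn =>
      obtain ⟨w, hw, hw0⟩ := h₁ 0 (Nat.succ_pos _)
      obtain ⟨w, rfl⟩ := Nat.exists_eq_succ_of_ne_zero hw0
      have e : ∀ j, j + 1 + m = j + (m + 1) := fun j => by ring
      rw [e]
      refine .of_step (.next (ih (by simpa using hw)) (ihn (m + 1) (by rwa [← e]) fun j hj => ?_))
      rw [← e]
      exact h₁ _ (Nat.succ_lt_succ hj)

/-- A halting run yields a finite list of triples; `Nat.unbeta` packs it into one number whose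
β-values are its entries. That number and the length witness `progF`. -/
theorem sat_progF_of_mem {ρ : ℕ → ℕ} {e x y : Tm} (h : y.val ρ ∈ prog (e.val ρ) (x.val ρ)) :
    Sat ρ (progF e x y) := by
  obtain ⟨L, hL, hmem⟩ := computes_of_mem_eval _ h
  rw [Denumerable.encode_ofNat] at hmem
  have hβ : ∀ k (h : k < L.length), Nat.beta (Nat.unbeta L) k = L[k] := fun k h =>
    Nat.beta_unbeta_coe L ⟨k, h⟩
  simp only [progF, sat_exs_succ, sat_exs_zero, sat_and, sat_all, sat_imp]
  refine ⟨Nat.unbeta L, L.length, ?_, fun k hk => ?_⟩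
  · obtain ⟨j, hj, hj'⟩ := List.getElem_of_mem hmem
    simp only [sat_beforeF]
    exact ⟨j, by simpa using hj, by simpa [hβ j hj] using hj'⟩
  · have hk' : k < L.length := by simpa using hk
    obtain ⟨c, x, y, h₁, h₂⟩ := hL k hk'
    refine ⟨c, x, y, by simpa [hβ k hk'] using h₁, sat_stepF_of_step ?_⟩
    refine Step.mono (fun c x y h' => ?_) (by simpa using h₂)
    obtain ⟨j, hj, hj'⟩ := List.mem_take_iff_getElem.1 h'
    have hj : j < k := by omega
    exact ⟨j, by simpa using hj, by simpa [hβ j (hj.trans hk')] using hj'⟩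

theorem sat_aboveF_of_lists {ρ : ℕ → ℕ} {e p q : Tm} {a b : ℕ} (h : Lists (e.val ρ) a b)
    (hlt : p.val ρ * (b + 1) < a * q.val ρ) : Sat ρ (aboveF e p q) := by
  obtain ⟨hab, n, hn⟩ := h
  simp only [aboveF, listsF, sat_exs_succ, sat_exs_zero, sat_and]
  exact ⟨a, b, ⟨by simpa using hab, n, Nat.pair a b, by simp, sat_progF_of_mem (by simpa using hn)⟩,
    by simpa using hlt⟩

/-- Reals that equal `1` do not lie in the open unit interval, as PA sees it. -/
theorem not_sat_unitF_of_ceReal_eq_one {ρ : ℕ → ℕ} {e : Tm} (h : ceReal (e.val ρ) = 1) :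
    ¬ Sat ρ (unitF e) := by
  simp only [unitF, belowF, sat_and, sat_exs_succ, sat_exs_zero, sat_neg, not_and]
  rintro - ⟨p, q, hq, hpq, hn⟩
  have hq : 0 < q := by simpa using hq
  have hpq : p < q := by simpa using hpq
  refine hn ?_
  have hlt : (p : ℝ) / q < ceReal (e.val ρ) := by
    rw [h, div_lt_one (by exact_mod_cast hq)]
    exact_mod_cast hpq
  -- Were nothing listed, the supremum would take the default value `0`, not `1`.
  have hne : {x : ℝ | ∃ a b, Lists (e.val ρ) a b ∧ x = a / (b + 1)}.Nonempty := by
    by_contra hne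
    rw [Set.not_nonempty_iff_eq_empty] at hne
    rw [ceReal, hne, Real.sSup_empty] at h
    exact zero_ne_one h
  obtain ⟨_, ⟨a, b, hab, rfl⟩, hlt⟩ := exists_lt_of_lt_csSup hne hlt
  rw [div_lt_div_iff₀ (by exact_mod_cast hq) (by positivity)] at hlt
  exact sat_aboveF_of_lists (a := a) (b := b) (by simpa using hab) (by
    simpa using (by exact_mod_cast hlt : p * (b + 1) < a * q))

theorem not_provablyRandom_of_ceReal_eq_one {e : ℕ} (h : ceReal e = 1) : ¬ ProvablyRandom e := by
  rintro ⟨h₁, -⟩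
  have := (sat_subst ..).1 (h₁.sat fun _ => 0)
  exact not_sat_unitF_of_ceReal_eq_one (by simpa using h) this

/-! ## Horn clauses over the pairing function -/

/-- Expressions for numbers built from variables, constants, successor and pairing. -/
inductive Pat : Type
  | x (i : ℕ) : Pat
  | const (n : ℕ) : Pat
  | succ (p : Pat) : Pat
  | pair (p q : Pat) : Pat

/-- Assignments are finite lists, so that they can be coded by numbers; variables beyond the end get
the value `0`. -/
def Pat.eval (σ : List ℕ) : Pat → ℕ
  | x i => σ.getD i 0
  | const n => n
  | succ p => p.eval σ + 1
  | pair p q => Nat.pair (p.eval σ) (q.eval σ)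

theorem Pat.primrec_eval (p : Pat) : Primrec fun σ : List ℕ => p.eval σ := by
  induction p with
  | x i => exact (Primrec.list_getD 0).comp Primrec.id (Primrec.const i)
  | const n => exact Primrec.const n
  | succ p ih => exact Primrec.succ.comp ih
  | pair p q ihp ihq => exact Primrec₂.natPair.comp ihp ihq

structure Clause : Type where
  prems : List Pat
  concl : Pat

/-- The least set of numbers closed under the clauses in `R`. -/
inductive Horn (R : List Clause) : ℕ → Prop
  | intro (r : Clause) (hr : r ∈ R) (σ : List ℕ) (h : ∀ p ∈ r.prems, Horn R (p.eval σ)) :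
      Horn R (r.concl.eval σ)

namespace Clause

/-- Add the conclusion of a clause to a list of facts, if the premises are there. -/
def apply (r : Clause) (σ l : List ℕ) : List ℕ :=
  if ∀ p ∈ r.prems, p.eval σ ∈ l then r.concl.eval σ :: l else l

def applyAll (R : List Clause) (σ l : List ℕ) : List ℕ := R.foldr (fun r l => r.apply σ l) l

/-- The facts obtained by successively using the instances given by the assignments in `L`. -/
def derive (R : List Clause) (L : List (List ℕ)) : List ℕ := L.foldr (applyAll R) []

/-- The premise list is fixed, so the quantifier unrolls to a finite conjunction and patterns
themselves need not be coded. -/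
theorem primrecPred_prems (ps : List Pat) :
    PrimrecPred fun z : List ℕ × List ℕ => ∀ p ∈ ps, p.eval z.1 ∈ z.2 := by
  have hmem : PrimrecRel fun (l : List ℕ) (a : ℕ) => a ∈ l :=
    (Primrec.eq (α := ℕ)).exists_mem_list.of_eq fun l a => by simp
  induction ps with
  | nil =>
    have : PrimrecPred fun _ : List ℕ × List ℕ => (0 : ℕ) = 0 :=
      Primrec.eq.comp (Primrec.const 0) (Primrec.const 0)
    exact this.of_eq fun z => by simp
  | cons p ps ih =>
    exact ((hmem.comp Primrec.snd (p.primrec_eval.comp Primrec.fst)).and ih).of_eq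
      fun z => by simp

theorem primrec_apply (r : Clause) : Primrec fun z : List ℕ × List ℕ => r.apply z.1 z.2 := by
  exact Primrec.ite (primrecPred_prems r.prems)
    (Primrec.list_cons.comp (r.concl.primrec_eval.comp Primrec.fst) Primrec.snd) Primrec.snd

theorem primrec_applyAll (R : List Clause) : Primrec₂ (applyAll R) := by
  induction R with
  | nil => exact Primrec.snd
  | cons r R ih => exact (primrec_apply r).comp (Primrec.pair Primrec.fst ih)

theorem primrec_derive (R : List Clause) : Primrec (derive R) :=
  Primrec.list_foldr (h := fun _ z => applyAll R z.1 z.2) Primrec.id (Primrec.const [])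
    ((primrec_applyAll R).comp (Primrec.fst.comp Primrec.snd) (Primrec.snd.comp Primrec.snd))

theorem subset_apply (r : Clause) (σ l : List ℕ) : l ⊆ r.apply σ l := by
  unfold apply
  split_ifs
  · exact List.subset_cons_self _ _
  · exact List.Subset.refl _

theorem apply_mono (r : Clause) (σ : List ℕ) {l l' : List ℕ} (h : l ⊆ l') :
    r.apply σ l ⊆ r.apply σ l' := by
  unfold apply
  split_ifs with h₁ h₂
  · exact List.cons_subset_cons _ h
  · exact absurd (fun p hp => h (h₁ p hp)) h₂
  · exact List.subset_cons_of_subset _ h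
  · exact h

theorem applyAll_mono (R : List Clause) (σ : List ℕ) {l l' : List ℕ} (h : l ⊆ l') :
    applyAll R σ l ⊆ applyAll R σ l' := by
  induction R with
  | nil => exact h
  | cons r R ih => exact apply_mono r σ ih

theorem subset_applyAll (R : List Clause) (σ l : List ℕ) : l ⊆ applyAll R σ l := by
  induction R with
  | nil => exact List.Subset.refl _
  | cons r R ih => exact List.Subset.trans ih (subset_apply ..)

theorem concl_mem_applyAll {R : List Clause} {r : Clause} (hr : r ∈ R) {σ l : List ℕ}
    (h : ∀ p ∈ r.prems, p.eval σ ∈ l) : r.concl.eval σ ∈ applyAll R σ l := by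
  induction R with
  | nil => simp at hr
  | cons r' R ih =>
    rcases List.mem_cons.1 hr with rfl | hr
    · have : ∀ p ∈ r.prems, p.eval σ ∈ applyAll R σ l := fun p hp => subset_applyAll _ _ _ (h p hp)
      change _ ∈ r.apply σ (applyAll R σ l)
      rw [apply, if_pos this]
      exact List.mem_cons_self
    · exact subset_apply _ _ _ (ih hr)

/-- In a right fold `M` is used first, and applying clauses is monotone in the facts already
present. With the next lemma, derivations of several premises merge by concatenation. -/
theorem derive_subset_append_left (R : List Clause) (L M : List (List ℕ)) :
    derive R L ⊆ derive R (L ++ M) := by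
  induction L with
  | nil => simp [derive]
  | cons σ L ih => exact applyAll_mono R σ ih

theorem derive_subset_append_right (R : List Clause) (L M : List (List ℕ)) :
    derive R M ⊆ derive R (L ++ M) := by
  induction L with
  | nil => exact List.Subset.refl _
  | cons σ L ih => exact List.Subset.trans ih (subset_applyAll ..)

theorem horn_of_mem_applyAll {R S : List Clause} (hS : S ⊆ R) {σ l : List ℕ}
    (hl : ∀ n ∈ l, Horn R n) : ∀ n ∈ applyAll S σ l, Horn R n := by
  induction S with
  | nil => exact hl
  | cons r S ih =>
    rw [List.cons_subset] at hS
    intro n hn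
    change n ∈ r.apply σ (applyAll S σ l) at hn
    unfold apply at hn
    split_ifs at hn with h
    · rcases List.mem_cons.1 hn with rfl | hn
      · exact .intro r hS.1 σ fun p hp => ih hS.2 _ (h p hp)
      · exact ih hS.2 n hn
    · exact ih hS.2 n hn

theorem horn_iff_exists_derive {R : List Clause} {n : ℕ} : Horn R n ↔ ∃ L, n ∈ derive R L := by
  constructor
  · intro h
    induction h with
    | intro r hr σ _ ih =>
      -- One list of assignments serves all premises. Then `σ :: L` uses `σ` last, when the premises
      -- are available.
      obtain ⟨L, hL⟩ : ∃ L, ∀ p ∈ r.prems, p.eval σ ∈ derive R L := by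
        generalize r.prems = ps at ih
        induction ps with
        | nil => exact ⟨[], by simp⟩
        | cons p ps ihp =>
          obtain ⟨L, hL⟩ := ihp fun q hq => ih q (List.mem_cons_of_mem _ hq)
          obtain ⟨M, hM⟩ := ih p List.mem_cons_self
          refine ⟨M ++ L, fun q hq => ?_⟩
          rcases List.mem_cons.1 hq with rfl | hq
          · exact derive_subset_append_left R M L hM
          · exact derive_subset_append_right R M L (hL q hq)
      exact ⟨σ :: L, concl_mem_applyAll hr hL⟩
  · rintro ⟨L, hL⟩
    revert n
    induction L with
    | nil => simp [derive]
    | cons σ L ih => exact fun {n} hn => horn_of_mem_applyAll (List.Subset.refl _) (fun m => ih) n hn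

end Clause

/-- A section of a set generated by Horn clauses has a primitive recursive enumeration. -/
theorem exists_primrec_enum_horn (R : List Clause) (T : ℕ) :
    ∃ f : ℕ → Option ℕ, Primrec f ∧ ∀ e, (∃ i, f i = some e) ↔ Horn R (Nat.pair T e) := by
  have hmem : PrimrecRel fun (l : List ℕ) (a : ℕ) => a ∈ l :=
    (Primrec.eq (α := ℕ)).exists_mem_list.of_eq fun l a => by simp
  -- The stage `i` codes a candidate and a certificate, namely a list of assignments; the candidate
  -- is output if the certificate derives it.
  refine ⟨fun i => if Nat.pair T i.unpair.1 ∈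
    Clause.derive R (Denumerable.ofNat (List (List ℕ)) i.unpair.2) then some i.unpair.1 else none,
    ?_, fun e => ?_⟩
  · have h₁ : Primrec fun i : ℕ => i.unpair.1 := Primrec.fst.comp Primrec.unpair
    have h₂ : Primrec fun i : ℕ => i.unpair.2 := Primrec.snd.comp Primrec.unpair
    exact Primrec.ite (hmem.comp ((Clause.primrec_derive R).comp ((Primrec.ofNat _).comp h₂))
      (Primrec₂.natPair.comp (Primrec.const T) h₁)) (Primrec.option_some.comp h₁)
      (Primrec.const none)
  · rw [Clause.horn_iff_exists_derive]
    constructor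
    · rintro ⟨i, hi⟩
      beta_reduce at hi
      split_ifs at hi with h
      obtain rfl := Option.some.inj hi
      exact ⟨_, h⟩
    · rintro ⟨L, hL⟩
      refine ⟨Nat.pair e (Encodable.encode L), ?_⟩
      simpa using hL

/-! ## Provability as a set generated by Horn clauses -/

/-- Built from pairing and successor only, so that clauses can spell out codes as patterns; the
successor separates tagged nodes from `0`. -/
def Tm.code : Tm → ℕ
  | var i => Nat.pair 1 i + 1
  | zero => 0
  | one => Nat.pair 0 0 + 1
  | add t u => Nat.pair 2 (Nat.pair t.code u.code) + 1
  | mul t u => Nat.pair 3 (Nat.pair t.code u.code) + 1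

/-- A left inverse of `Tm.code`. -/
def decodeTm : ℕ → Tm
  | 0 => .zero
  | n + 1 =>
    have _ : n.unpair.2.unpair.1 ≤ n := (Nat.unpair_left_le _).trans (Nat.unpair_right_le _)
    have _ : n.unpair.2.unpair.2 ≤ n := (Nat.unpair_right_le _).trans (Nat.unpair_right_le _)
    match n.unpair.1 with
    | 0 => .one
    | 1 => .var n.unpair.2
    | 2 => .add (decodeTm n.unpair.2.unpair.1) (decodeTm n.unpair.2.unpair.2)
    | _ => .mul (decodeTm n.unpair.2.unpair.1) (decodeTm n.unpair.2.unpair.2)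

def Fml.code : Fml → ℕ
  | bot => 0
  | eq t u => Nat.pair 0 (Nat.pair t.code u.code) + 1
  | lt t u => Nat.pair 1 (Nat.pair t.code u.code) + 1
  | imp φ ψ => Nat.pair 2 (Nat.pair φ.code ψ.code) + 1
  | all φ => Nat.pair 3 φ.code + 1

/-- A left inverse of `Fml.code`. -/
def decodeFml : ℕ → Fml
  | 0 => bot
  | n + 1 =>
    have _ : n.unpair.2 ≤ n := Nat.unpair_right_le _
    have _ : n.unpair.2.unpair.1 ≤ n := (Nat.unpair_left_le _).trans (Nat.unpair_right_le _)
    have _ : n.unpair.2.unpair.2 ≤ n := (Nat.unpair_right_le _).trans (Nat.unpair_right_le _)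
    match n.unpair.1 with
    | 0 => eq (decodeTm n.unpair.2.unpair.1) (decodeTm n.unpair.2.unpair.2)
    | 1 => lt (decodeTm n.unpair.2.unpair.1) (decodeTm n.unpair.2.unpair.2)
    | 2 => imp (decodeFml n.unpair.2.unpair.1) (decodeFml n.unpair.2.unpair.2)
    | _ => all (decodeFml n.unpair.2)

section Decode

@[simp] theorem decodeTm_zero : decodeTm 0 = .zero := by rw [decodeTm]
@[simp] theorem decodeTm_one : decodeTm (Nat.pair 0 0 + 1) = .one := by rw [decodeTm]; simp
@[simp] theorem decodeTm_var (i : ℕ) : decodeTm (Nat.pair 1 i + 1) = .var i := by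
  rw [decodeTm]; simp
@[simp] theorem decodeTm_add (a b : ℕ) :
    decodeTm (Nat.pair 2 (Nat.pair a b) + 1) = .add (decodeTm a) (decodeTm b) := by
  rw [decodeTm]; simp
@[simp] theorem decodeTm_mul (a b : ℕ) :
    decodeTm (Nat.pair 3 (Nat.pair a b) + 1) = .mul (decodeTm a) (decodeTm b) := by
  rw [decodeTm]; simp
@[simp] theorem decodeFml_bot : decodeFml 0 = bot := by rw [decodeFml]
@[simp] theorem decodeFml_eq (a b : ℕ) :
    decodeFml (Nat.pair 0 (Nat.pair a b) + 1) = eq (decodeTm a) (decodeTm b) := by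
  rw [decodeFml]; simp
@[simp] theorem decodeFml_lt (a b : ℕ) :
    decodeFml (Nat.pair 1 (Nat.pair a b) + 1) = lt (decodeTm a) (decodeTm b) := by
  rw [decodeFml]; simp
@[simp] theorem decodeFml_imp (a b : ℕ) :
    decodeFml (Nat.pair 2 (Nat.pair a b) + 1) = imp (decodeFml a) (decodeFml b) := by
  rw [decodeFml]; simp
@[simp] theorem decodeFml_all (a : ℕ) : decodeFml (Nat.pair 3 a + 1) = all (decodeFml a) := by
  rw [decodeFml]; simp

@[simp] theorem decodeTm_code (t : Tm) : decodeTm t.code = t := by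
  induction t with
  | var i => exact decodeTm_var i
  | zero => exact decodeTm_zero
  | one => exact decodeTm_one
  | add t u iht ihu => rw [Tm.code, decodeTm_add, iht, ihu]
  | mul t u iht ihu => rw [Tm.code, decodeTm_mul, iht, ihu]

@[simp] theorem decodeFml_code (φ : Fml) : decodeFml φ.code = φ := by
  induction φ with
  | bot => exact decodeFml_bot
  | eq t u => rw [Fml.code, decodeFml_eq, decodeTm_code, decodeTm_code]
  | lt t u => rw [Fml.code, decodeFml_lt, decodeTm_code, decodeTm_code]
  | imp φ ψ ihφ ihψ => rw [Fml.code, decodeFml_imp, ihφ, ihψ]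
  | all φ ih => rw [Fml.code, decodeFml_all, ih]

end Decode

/-- The meaning of the facts that the clauses below derive: a fact consists of a tag for the kind
of statement and the tuple of its arguments. -/
def Holds (n : ℕ) : Prop :=
  let a := n.unpair.2.unpair.1
  let m := n.unpair.2.unpair.2
  let b := m.unpair.1
  let c := m.unpair.2
  match n.unpair.1 with
  | 0 => a < m
  | 1 => decodeTm c = (decodeTm b).lift a
  | 2 => decodeTm c.unpair.2 = Tm.subst a (decodeTm b) (decodeTm c.unpair.1)
  | 3 => decodeFml c = (decodeFml b).lift a
  | 4 => decodeFml c.unpair.2 = (decodeFml c.unpair.1).subst a (decodeTm b)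
  | 5 => decodeTm m = num a
  | 6 => PAProves (decodeFml n.unpair.2)
  | _ => ProvablyRandom n.unpair.2

section Holds

@[simp] theorem holds_lt (a b : ℕ) : Holds (Nat.pair 0 (Nat.pair a b)) ↔ a < b := by
  simp [Holds]
@[simp] theorem holds_liftTm (k t u : ℕ) : Holds (Nat.pair 1 (Nat.pair k (Nat.pair t u))) ↔
    decodeTm u = (decodeTm t).lift k := by
  simp [Holds]
@[simp] theorem holds_substTm (k s t u : ℕ) :
    Holds (Nat.pair 2 (Nat.pair k (Nat.pair s (Nat.pair t u)))) ↔
      decodeTm u = Tm.subst k (decodeTm s) (decodeTm t) := by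
  simp [Holds]
@[simp] theorem holds_liftFml (k φ ψ : ℕ) : Holds (Nat.pair 3 (Nat.pair k (Nat.pair φ ψ))) ↔
    decodeFml ψ = (decodeFml φ).lift k := by
  simp [Holds]
@[simp] theorem holds_substFml (k s φ ψ : ℕ) :
    Holds (Nat.pair 4 (Nat.pair k (Nat.pair s (Nat.pair φ ψ)))) ↔
      decodeFml ψ = (decodeFml φ).subst k (decodeTm s) := by
  simp [Holds]
@[simp] theorem holds_num (n t : ℕ) : Holds (Nat.pair 5 (Nat.pair n t)) ↔
    decodeTm t = num n := by
  simp [Holds]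
@[simp] theorem holds_proves (φ : ℕ) : Holds (Nat.pair 6 φ) ↔ PAProves (decodeFml φ) := by
  simp [Holds]
@[simp] theorem holds_random (e : ℕ) : Holds (Nat.pair 7 e) ↔ ProvablyRandom e := by
  simp [Holds]

end Holds

namespace Pat

abbrev var (p : Pat) : Pat := succ (pair (const 1) p)
abbrev zero : Pat := const 0
abbrev one : Pat := succ (pair (const 0) (const 0))
abbrev add (p q : Pat) : Pat := succ (pair (const 2) (pair p q))
abbrev mul (p q : Pat) : Pat := succ (pair (const 3) (pair p q))
abbrev bot : Pat := const 0
abbrev eq (p q : Pat) : Pat := succ (pair (const 0) (pair p q))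
abbrev lt (p q : Pat) : Pat := succ (pair (const 1) (pair p q))
abbrev imp (p q : Pat) : Pat := succ (pair (const 2) (pair p q))
abbrev all (p : Pat) : Pat := succ (pair (const 3) p)

abbrev isLt (p q : Pat) : Pat := pair (const 0) (pair p q)
abbrev isLiftTm (k t u : Pat) : Pat := pair (const 1) (pair k (pair t u))
abbrev isSubstTm (k s t u : Pat) : Pat := pair (const 2) (pair k (pair s (pair t u)))
abbrev isLiftFml (k t u : Pat) : Pat := pair (const 3) (pair k (pair t u))
abbrev isSubstFml (k s t u : Pat) : Pat := pair (const 4) (pair k (pair s (pair t u)))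
abbrev isNum (n t : Pat) : Pat := pair (const 5) (pair n t)
abbrev isProved (p : Pat) : Pat := pair (const 6) p
abbrev isRandom (p : Pat) : Pat := pair (const 7) p

end Pat

namespace Clause
open Pat

def ltZero : Clause := ⟨[], isLt (const 0) (succ (x 0))⟩
def ltSucc : Clause := ⟨[isLt (x 0) (x 1)], isLt (succ (x 0)) (succ (x 1))⟩
def numZero : Clause := ⟨[], isNum (const 0) zero⟩
def numSucc : Clause := ⟨[isNum (x 0) (x 1)], isNum (succ (x 0)) (add (x 1) one)⟩

def liftVarLt : Clause := ⟨[isLt (x 1) (x 0)], isLiftTm (x 0) (var (x 1)) (var (x 1))⟩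
-- The condition `k ≤ i` is written `k < i + 1`, since the clauses generate only the strict order.
def liftVarGe : Clause :=
  ⟨[isLt (x 0) (succ (x 1))], isLiftTm (x 0) (var (x 1)) (var (succ (x 1)))⟩
def liftZero : Clause := ⟨[], isLiftTm (x 0) zero zero⟩
def liftOne : Clause := ⟨[], isLiftTm (x 0) one one⟩
def liftAdd : Clause := ⟨[isLiftTm (x 0) (x 1) (x 3), isLiftTm (x 0) (x 2) (x 4)],
  isLiftTm (x 0) (add (x 1) (x 2)) (add (x 3) (x 4))⟩
def liftMul : Clause := ⟨[isLiftTm (x 0) (x 1) (x 3), isLiftTm (x 0) (x 2) (x 4)],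
  isLiftTm (x 0) (mul (x 1) (x 2)) (mul (x 3) (x 4))⟩

def substVarLt : Clause :=
  ⟨[isLt (x 2) (x 0)], isSubstTm (x 0) (x 1) (var (x 2)) (var (x 2))⟩
def substVarEq : Clause := ⟨[], isSubstTm (x 0) (x 1) (var (x 0)) (x 1)⟩
def substVarGt : Clause :=
  ⟨[isLt (x 0) (succ (x 2))], isSubstTm (x 0) (x 1) (var (succ (x 2))) (var (x 2))⟩
def substZero : Clause := ⟨[], isSubstTm (x 0) (x 1) zero zero⟩
def substOne : Clause := ⟨[], isSubstTm (x 0) (x 1) one one⟩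
def substAdd : Clause :=
  ⟨[isSubstTm (x 0) (x 1) (x 2) (x 4), isSubstTm (x 0) (x 1) (x 3) (x 5)],
    isSubstTm (x 0) (x 1) (add (x 2) (x 3)) (add (x 4) (x 5))⟩
def substMul : Clause :=
  ⟨[isSubstTm (x 0) (x 1) (x 2) (x 4), isSubstTm (x 0) (x 1) (x 3) (x 5)],
    isSubstTm (x 0) (x 1) (mul (x 2) (x 3)) (mul (x 4) (x 5))⟩

def liftBot : Clause := ⟨[], isLiftFml (x 0) bot bot⟩
def liftEq : Clause := ⟨[isLiftTm (x 0) (x 1) (x 3), isLiftTm (x 0) (x 2) (x 4)],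
  isLiftFml (x 0) (eq (x 1) (x 2)) (eq (x 3) (x 4))⟩
def liftLt : Clause := ⟨[isLiftTm (x 0) (x 1) (x 3), isLiftTm (x 0) (x 2) (x 4)],
  isLiftFml (x 0) (lt (x 1) (x 2)) (lt (x 3) (x 4))⟩
def liftImp : Clause := ⟨[isLiftFml (x 0) (x 1) (x 3), isLiftFml (x 0) (x 2) (x 4)],
  isLiftFml (x 0) (imp (x 1) (x 2)) (imp (x 3) (x 4))⟩
def liftAll : Clause :=
  ⟨[isLiftFml (succ (x 0)) (x 1) (x 2)], isLiftFml (x 0) (all (x 1)) (all (x 2))⟩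

def substBot : Clause := ⟨[], isSubstFml (x 0) (x 1) bot bot⟩
def substEq : Clause :=
  ⟨[isSubstTm (x 0) (x 1) (x 2) (x 4), isSubstTm (x 0) (x 1) (x 3) (x 5)],
    isSubstFml (x 0) (x 1) (eq (x 2) (x 3)) (eq (x 4) (x 5))⟩
def substLt : Clause :=
  ⟨[isSubstTm (x 0) (x 1) (x 2) (x 4), isSubstTm (x 0) (x 1) (x 3) (x 5)],
    isSubstFml (x 0) (x 1) (lt (x 2) (x 3)) (lt (x 4) (x 5))⟩
def substImp : Clause :=
  ⟨[isSubstFml (x 0) (x 1) (x 2) (x 4), isSubstFml (x 0) (x 1) (x 3) (x 5)],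
    isSubstFml (x 0) (x 1) (imp (x 2) (x 3)) (imp (x 4) (x 5))⟩
-- Patterns cannot compute a lift, so the lifted term is an extra variable pinned down by a premise.
-- The clauses for instantiation, Leibniz' law and induction use the same device for substitutions.
def substAll : Clause :=
  ⟨[isLiftTm (const 0) (x 1) (x 4), isSubstFml (succ (x 0)) (x 4) (x 2) (x 3)],
    isSubstFml (x 0) (x 1) (all (x 2)) (all (x 3))⟩

def logicK : Clause := ⟨[], isProved (imp (x 0) (imp (x 1) (x 0)))⟩
def logicS : Clause := ⟨[], isProved (imp (imp (x 0) (imp (x 1) (x 2)))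
  (imp (imp (x 0) (x 1)) (imp (x 0) (x 2))))⟩
def logicDne : Clause := ⟨[], isProved (imp (imp (imp (x 0) bot) bot) (x 0))⟩
def logicInst : Clause :=
  ⟨[isSubstFml (const 0) (x 1) (x 0) (x 2)], isProved (imp (all (x 0)) (x 2))⟩
def logicDistrib : Clause :=
  ⟨[], isProved (imp (all (imp (x 0) (x 1))) (imp (all (x 0)) (all (x 1))))⟩
def logicVacuous : Clause :=
  ⟨[isLiftFml (const 0) (x 0) (x 1)], isProved (imp (x 0) (all (x 1)))⟩
def logicRefl : Clause := ⟨[], isProved (eq (x 0) (x 0))⟩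
def logicLeibniz : Clause :=
  ⟨[isSubstFml (const 0) (x 1) (x 0) (x 3), isSubstFml (const 0) (x 2) (x 0) (x 4)],
    isProved (imp (eq (x 1) (x 2)) (imp (x 3) (x 4)))⟩
def logicMp : Clause := ⟨[isProved (imp (x 0) (x 1)), isProved (x 0)], isProved (x 1)⟩
def logicGen : Clause := ⟨[isProved (x 0)], isProved (all (x 0))⟩

def induction : Clause :=
  ⟨[isSubstFml (const 0) zero (x 0) (x 1), isLiftFml (const 1) (x 0) (x 2),
    isSubstFml (const 0) (add (var (const 0)) one) (x 2) (x 3)],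
    isProved (imp (x 1) (imp (all (imp (x 0) (x 3))) (all (x 0))))⟩

/-- The rule that makes `e` provably random by proofs of `φ` and `ψ` for `e`. -/
def random (φ ψ : Fml) : Clause :=
  ⟨[isNum (x 0) (x 1), isSubstFml (const 0) (x 1) (const φ.code) (x 2), isProved (x 2),
    isSubstFml (const 0) (x 1) (const ψ.code) (x 3), isProved (x 3)], isRandom (x 0)⟩

/-- The axioms of Peano arithmetic other than induction. -/
def finiteAxioms : List Fml :=
  [Fml.eq ((v 0 + v 1) + v 2) (v 0 + (v 1 + v 2)),
    Fml.eq (v 0 + v 1) (v 1 + v 0),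
    Fml.eq ((v 0 * v 1) * v 2) (v 0 * (v 1 * v 2)),
    Fml.eq (v 0 * v 1) (v 1 * v 0),
    Fml.eq (v 0 * (v 1 + v 2)) (v 0 * v 1 + v 0 * v 2),
    Fml.and (Fml.eq (v 0 + 0) (v 0)) (Fml.eq (v 0 * 0) 0),
    Fml.eq (v 0 * 1) (v 0),
    Fml.imp (Fml.and (Fml.lt (v 0) (v 1)) (Fml.lt (v 1) (v 2))) (Fml.lt (v 0) (v 2)),
    Fml.neg (Fml.lt (v 0) (v 0)),
    Fml.or (Fml.lt (v 0) (v 1)) (Fml.or (Fml.eq (v 0) (v 1)) (Fml.lt (v 1) (v 0))),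
    Fml.imp (Fml.lt (v 0) (v 1)) (Fml.lt (v 0 + v 2) (v 1 + v 2)),
    Fml.imp (Fml.and (Fml.lt 0 (v 2)) (Fml.lt (v 0) (v 1))) (Fml.lt (v 0 * v 2) (v 1 * v 2)),
    Fml.imp (Fml.lt (v 0) (v 1)) (Fml.ex (Fml.eq (v 1 + v 0) (v 2))),
    Fml.and (Fml.lt 0 1) (Fml.imp (Fml.lt 0 (v 0)) (Fml.or (Fml.lt 1 (v 0)) (Fml.eq 1 (v 0)))),
    Fml.or (Fml.lt 0 (v 0)) (Fml.eq 0 (v 0))]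

def arithmetic : List Clause :=
  [ltZero, ltSucc, numZero, numSucc]

def syntactic : List Clause :=
  [liftVarLt, liftVarGe, liftZero, liftOne, liftAdd, liftMul,
    substVarLt, substVarEq, substVarGt, substZero, substOne, substAdd, substMul,
    liftBot, liftEq, liftLt, liftImp, liftAll, substBot, substEq, substLt, substImp, substAll]

def logical : List Clause :=
  [logicK, logicS, logicDne, logicInst, logicDistrib, logicVacuous, logicRefl, logicLeibniz,
    logicMp, logicGen, induction]

def provability : List Clause :=
  arithmetic ++ syntactic ++ logical ++
    finiteAxioms.map (fun φ => ⟨[], isProved (const φ.code)⟩) ++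
    [random (unitF (v 0)) (chaitinF (v 0)), random (unitF (v 0)) (solovayF (v 0))]

end Clause

/-- Each of the finitely many single axioms becomes a clause without premises and variables; only
the induction scheme needs a clause with variables. -/
theorem paAxiom_iff {φ : Fml} : PAAxiom φ ↔ φ ∈ Clause.finiteAxioms ∨
    ∃ ψ : Fml, φ = imp (ψ.subst 0 0)
      (imp (all (imp ψ ((ψ.lift 1).subst 0 (v 0 + 1)))) (all ψ)) := by
  constructor
  · intro h
    cases h with
    | induction ψ => exact .inr ⟨ψ, rfl⟩
    | _ => left; simp [Clause.finiteAxioms]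
  · rintro (h | ⟨ψ, rfl⟩)
    · simp only [Clause.finiteAxioms, List.mem_cons, List.not_mem_nil, or_false] at h
      rcases h with rfl | rfl | rfl | rfl | rfl | rfl | rfl | rfl | rfl | rfl | rfl | rfl | rfl |
        rfl | rfl <;> constructor
    · exact .induction ψ

/-! ### Soundness of the clauses. -/

/-- A clause all of whose instances are correct. -/
def Clause.Sound (r : Clause) : Prop :=
  ∀ σ, (∀ p ∈ r.prems, Holds (p.eval σ)) → Holds (r.concl.eval σ)

theorem Clause.sound_arithmetic : ∀ r ∈ Clause.arithmetic, r.Sound := by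
  simp only [arithmetic, List.forall_mem_cons, List.not_mem_nil, false_imp_iff, implies_true,
    and_true]
  refine ⟨fun σ h => ?_, fun σ h => ?_, fun σ h => ?_, fun σ h => ?_⟩
  · simp [ltZero, Pat.eval]
  · simpa [ltSucc, Pat.eval] using h
  · simp [numZero, Pat.eval]; rfl
  · simp only [numSucc, Pat.eval, List.forall_mem_cons, List.not_mem_nil, false_imp_iff,
      implies_true, and_true, holds_num, decodeTm_add, decodeTm_one] at h ⊢
    rw [h]; rfl

/-- Clause variables range over all numbers, including those that code nothing. Decoding is total
and commutes with the constructors, so every instance becomes an unfolding of `lift` or `subst` on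
decoded objects. -/
theorem Clause.sound_syntactic : ∀ r ∈ Clause.syntactic, r.Sound := by
  intro r hr σ h
  simp only [syntactic, List.mem_cons, List.not_mem_nil, or_false] at hr
  rcases hr with rfl | rfl | rfl | rfl | rfl | rfl | rfl | rfl | rfl | rfl | rfl | rfl | rfl |
    rfl | rfl | rfl | rfl | rfl | rfl | rfl | rfl | rfl | rfl <;>
  simp only [liftVarLt, liftVarGe, liftZero, liftOne, liftAdd, liftMul,
    substVarLt, substVarEq, substVarGt, substZero, substOne, substAdd, substMul,
    liftBot, liftEq, liftLt, liftImp, liftAll, substBot, substEq, substLt, substImp, substAll,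
    Pat.eval, List.forall_mem_cons, List.not_mem_nil, false_imp_iff, implies_true, and_true,
    holds_lt, holds_liftTm, holds_substTm, holds_liftFml, holds_substFml, decodeTm_zero,
    decodeTm_one, decodeTm_var, decodeTm_add, decodeTm_mul, decodeFml_bot, decodeFml_eq,
    decodeFml_lt, decodeFml_imp, decodeFml_all] at h ⊢
  case inr.inl => rw [Tm.lift, if_neg (by omega)]
  -- This is `substVarGt`: the index is written as a successor, so lowering it by one gives back the
  -- pattern variable.
  case inr.inr.inr.inr.inr.inr.inr.inr.inl =>
    have h₁ : ¬ σ.getD 2 0 + 1 < σ.getD 0 0 := by omega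
    have h₂ : σ.getD 2 0 + 1 ≠ σ.getD 0 0 := by omega
    simp only [Tm.subst, if_neg h₁, if_neg h₂, Nat.add_sub_cancel]
  all_goals first
    | rw [Tm.lift, if_pos h]
    | rw [Tm.subst, if_pos h]
    | rw [Tm.subst, if_neg (lt_irrefl _), if_pos rfl]
    | simp only [Tm.lift, Tm.subst, Fml.lift, Fml.subst, h]

theorem Clause.sound_logical : ∀ r ∈ Clause.logical, r.Sound := by
  intro r hr σ h
  simp only [logical, List.mem_cons, List.not_mem_nil, or_false] at hr
  rcases hr with rfl | rfl | rfl | rfl | rfl | rfl | rfl | rfl | rfl | rfl | rfl <;>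
  simp only [logicK, logicS, logicDne, logicInst, logicDistrib, logicVacuous, logicRefl,
    logicLeibniz, logicMp, logicGen, induction,
    Pat.eval, List.forall_mem_cons, List.not_mem_nil, false_imp_iff, implies_true, and_true,
    holds_liftFml, holds_substFml, holds_proves, decodeTm_zero,
    decodeTm_one, decodeTm_var, decodeTm_add, decodeFml_bot, decodeFml_eq,
    decodeFml_imp, decodeFml_all] at h ⊢
  · exact .k _ _
  · exact .s _ _ _
  · exact .dne _
  · rw [h]; exact .inst _ _
  · exact .distrib _ _
  · rw [h]; exact .vacuous _
  · exact .refl _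
  · rw [h.1, h.2]; exact .leibniz _ _ _
  · exact .mp h.1 h.2
  · exact .gen h
  · rw [h.1, h.2.2, h.2.1]; exact .ax (.induction _)

theorem Clause.sound_random {φ ψ : Fml} (h : ∀ e, PAProves (φ.subst 0 (num e)) →
    PAProves (ψ.subst 0 (num e)) → ProvablyRandom e) : (random φ ψ).Sound := by
  intro σ hp
  simp only [random, Pat.eval, List.forall_mem_cons, List.not_mem_nil, false_imp_iff,
    implies_true, and_true, holds_num, holds_substFml, holds_proves, holds_random,
    decodeFml_code] at hp ⊢
  obtain ⟨h₁, h₂, h₃, h₄, h₅⟩ := hp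
  rw [h₂, h₁] at h₃
  rw [h₄, h₁] at h₅
  exact h _ h₃ h₅

theorem Clause.sound_provability : ∀ r ∈ Clause.provability, r.Sound := by
  intro r hr
  simp only [provability, List.mem_append, List.mem_map, List.mem_cons, List.not_mem_nil,
    or_false] at hr
  rcases hr with (((hr | hr) | hr) | ⟨φ, hφ, rfl⟩) | (rfl | rfl)
  · exact sound_arithmetic r hr
  · exact sound_syntactic r hr
  · exact sound_logical r hr
  · intro σ _
    simp only [Pat.eval, holds_proves, decodeFml_code]
    exact .ax (paAxiom_iff.2 (.inl hφ))
  · exact sound_random fun e h₁ h₂ => ⟨h₁, .inl h₂⟩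
  · exact sound_random fun e h₁ h₂ => ⟨h₁, .inr h₂⟩

theorem Horn.holds {n : ℕ} (h : Horn Clause.provability n) : Holds n := by
  induction h with
  | intro r hr σ _ ih => exact Clause.sound_provability r hr σ ih

/-! ### Completeness of the clauses. -/

section Complete
open Clause

variable {R : List Clause} {p q r c : Pat}

/-- Evaluated patterns agree with concrete codes by unfolding, so with these rules it suffices below
to name a clause and an assignment. -/
theorem Horn.intro₀ (h : ⟨[], c⟩ ∈ R) (σ : List ℕ) : Horn R (c.eval σ) :=
  .intro _ h σ (by simp)

theorem Horn.intro₁ (h : ⟨[p], c⟩ ∈ R) (σ : List ℕ) (hp : Horn R (p.eval σ)) :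
    Horn R (c.eval σ) := .intro _ h σ (by simpa using hp)

theorem Horn.intro₂ (h : ⟨[p, q], c⟩ ∈ R) (σ : List ℕ) (hp : Horn R (p.eval σ))
    (hq : Horn R (q.eval σ)) : Horn R (c.eval σ) := .intro _ h σ (by simpa using ⟨hp, hq⟩)

theorem Horn.intro₃ (h : ⟨[p, q, r], c⟩ ∈ R) (σ : List ℕ) (hp : Horn R (p.eval σ))
    (hq : Horn R (q.eval σ)) (hr : Horn R (r.eval σ)) : Horn R (c.eval σ) :=
  .intro _ h σ (by simpa using ⟨hp, hq, hr⟩)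

theorem horn_lt {i k : ℕ} (h : i < k) : Horn provability (Nat.pair 0 (Nat.pair i k)) := by
  obtain ⟨k, rfl⟩ := Nat.exists_eq_succ_of_ne_zero (Nat.ne_zero_of_lt h)
  induction i generalizing k with
  | zero => exact .intro₀ (show ltZero ∈ _ by simp [provability, arithmetic]) [k]
  | succ i ih =>
    have h := Nat.lt_of_succ_lt_succ h
    obtain ⟨k, rfl⟩ := Nat.exists_eq_succ_of_ne_zero (Nat.ne_zero_of_lt h)
    exact .intro₁ (show ltSucc ∈ _ by simp [provability, arithmetic]) [i, k + 1] (ih k h)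

theorem horn_num (n : ℕ) : Horn provability (Nat.pair 5 (Nat.pair n (num n).code)) := by
  induction n with
  | zero => exact .intro₀ (show numZero ∈ _ by simp [provability, arithmetic]) []
  | succ n ih =>
    exact .intro₁ (show numSucc ∈ _ by simp [provability, arithmetic]) [n, (num n).code] ih

theorem horn_liftTm (k : ℕ) (t : Tm) :
    Horn provability (Nat.pair 1 (Nat.pair k (Nat.pair t.code (t.lift k).code))) := by
  induction t with
  | var i =>
    rw [Tm.lift]
    split_ifs with h
    · exact .intro₁ (show liftVarLt ∈ _ by simp [provability, syntactic]) [k, i] (horn_lt h)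
    · exact .intro₁ (show liftVarGe ∈ _ by simp [provability, syntactic]) [k, i]
        (horn_lt (show k < i + 1 by omega))
  | zero => exact .intro₀ (show liftZero ∈ _ by simp [provability, syntactic]) [k]
  | one => exact .intro₀ (show liftOne ∈ _ by simp [provability, syntactic]) [k]
  | add t u iht ihu =>
    exact .intro₂ (show liftAdd ∈ _ by simp [provability, syntactic])
      [k, t.code, u.code, (t.lift k).code, (u.lift k).code] iht ihu
  | mul t u iht ihu =>
    exact .intro₂ (show liftMul ∈ _ by simp [provability, syntactic])
      [k, t.code, u.code, (t.lift k).code, (u.lift k).code] iht ihu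

theorem horn_substTm (k : ℕ) (s t : Tm) : Horn provability
    (Nat.pair 2 (Nat.pair k (Nat.pair s.code (Nat.pair t.code (Tm.subst k s t).code)))) := by
  induction t with
  | var i =>
    rw [Tm.subst]
    split_ifs with h h'
    · exact .intro₁ (show substVarLt ∈ _ by simp [provability, syntactic]) [k, s.code, i]
        (horn_lt h)
    · subst h'
      exact .intro₀ (show substVarEq ∈ _ by simp [provability, syntactic]) [i, s.code]
    · obtain ⟨i, rfl⟩ := Nat.exists_eq_succ_of_ne_zero (show i ≠ 0 by omega)
      exact .intro₁ (show substVarGt ∈ _ by simp [provability, syntactic]) [k, s.code, i]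
        (horn_lt (show k < i + 1 by omega))
  | zero => exact .intro₀ (show substZero ∈ _ by simp [provability, syntactic]) [k, s.code]
  | one => exact .intro₀ (show substOne ∈ _ by simp [provability, syntactic]) [k, s.code]
  | add t u iht ihu =>
    exact .intro₂ (show substAdd ∈ _ by simp [provability, syntactic])
      [k, s.code, t.code, u.code, (Tm.subst k s t).code, (Tm.subst k s u).code] iht ihu
  | mul t u iht ihu =>
    exact .intro₂ (show substMul ∈ _ by simp [provability, syntactic])
      [k, s.code, t.code, u.code, (Tm.subst k s t).code, (Tm.subst k s u).code] iht ihu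

theorem horn_liftFml (k : ℕ) (φ : Fml) :
    Horn provability (Nat.pair 3 (Nat.pair k (Nat.pair φ.code (φ.lift k).code))) := by
  induction φ generalizing k with
  | bot => exact .intro₀ (show liftBot ∈ _ by simp [provability, syntactic]) [k]
  | eq t u =>
    exact .intro₂ (show liftEq ∈ _ by simp [provability, syntactic])
      [k, t.code, u.code, (t.lift k).code, (u.lift k).code] (horn_liftTm k t) (horn_liftTm k u)
  | lt t u =>
    exact .intro₂ (show liftLt ∈ _ by simp [provability, syntactic])
      [k, t.code, u.code, (t.lift k).code, (u.lift k).code] (horn_liftTm k t) (horn_liftTm k u)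
  | imp φ ψ ihφ ihψ =>
    exact .intro₂ (show liftImp ∈ _ by simp [provability, syntactic])
      [k, φ.code, ψ.code, (φ.lift k).code, (ψ.lift k).code] (ihφ k) (ihψ k)
  | all φ ih =>
    exact .intro₁ (show liftAll ∈ _ by simp [provability, syntactic])
      [k, φ.code, (φ.lift (k + 1)).code] (ih (k + 1))

theorem horn_substFml (k : ℕ) (s : Tm) (φ : Fml) : Horn provability
    (Nat.pair 4 (Nat.pair k (Nat.pair s.code (Nat.pair φ.code (φ.subst k s).code)))) := by
  induction φ generalizing k s with
  | bot => exact .intro₀ (show substBot ∈ _ by simp [provability, syntactic]) [k, s.code]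
  | eq t u =>
    exact .intro₂ (show substEq ∈ _ by simp [provability, syntactic])
      [k, s.code, t.code, u.code, (Tm.subst k s t).code, (Tm.subst k s u).code]
      (horn_substTm k s t) (horn_substTm k s u)
  | lt t u =>
    exact .intro₂ (show substLt ∈ _ by simp [provability, syntactic])
      [k, s.code, t.code, u.code, (Tm.subst k s t).code, (Tm.subst k s u).code]
      (horn_substTm k s t) (horn_substTm k s u)
  | imp φ ψ ihφ ihψ =>
    exact .intro₂ (show substImp ∈ _ by simp [provability, syntactic])
      [k, s.code, φ.code, ψ.code, (φ.subst k s).code, (ψ.subst k s).code] (ihφ k s) (ihψ k s)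
  | all φ ih =>
    exact .intro₂ (show substAll ∈ _ by simp [provability, syntactic])
      [k, s.code, φ.code, (φ.subst (k + 1) (s.lift 0)).code, (s.lift 0).code]
      (horn_liftTm 0 s) (ih (k + 1) (s.lift 0))

/-- Induction on the derivation, one clause for each rule; side conditions on lifts and
substitutions are met by the facts derived above. -/
theorem horn_of_paProves {φ : Fml} (h : PAProves φ) :
    Horn provability (Nat.pair 6 φ.code) := by
  induction h with
  | @ax φ h =>
    rcases paAxiom_iff.1 h with h | ⟨ψ, rfl⟩
    · refine .intro₀ (c := Pat.isProved (.const φ.code)) ?_ []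
      simp only [provability, List.mem_append, List.mem_map]
      exact .inl (.inr ⟨φ, h, rfl⟩)
    · exact .intro₃ (show induction ∈ _ by simp [provability, logical])
        [ψ.code, (ψ.subst 0 0).code, (ψ.lift 1).code, ((ψ.lift 1).subst 0 (v 0 + 1)).code]
        (horn_substFml 0 0 ψ) (horn_liftFml 1 ψ) (horn_substFml 0 (v 0 + 1) (ψ.lift 1))
  | k φ ψ =>
    exact .intro₀ (show logicK ∈ _ by simp [provability, logical]) [φ.code, ψ.code]
  | s φ ψ χ =>
    exact .intro₀ (show logicS ∈ _ by simp [provability, logical]) [φ.code, ψ.code, χ.code]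
  | dne φ => exact .intro₀ (show logicDne ∈ _ by simp [provability, logical]) [φ.code]
  | inst φ t =>
    exact .intro₁ (show logicInst ∈ _ by simp [provability, logical])
      [φ.code, t.code, (φ.subst 0 t).code] (horn_substFml 0 t φ)
  | distrib φ ψ =>
    exact .intro₀ (show logicDistrib ∈ _ by simp [provability, logical]) [φ.code, ψ.code]
  | vacuous φ =>
    exact .intro₁ (show logicVacuous ∈ _ by simp [provability, logical])
      [φ.code, (φ.lift 0).code] (horn_liftFml 0 φ)
  | refl t => exact .intro₀ (show logicRefl ∈ _ by simp [provability, logical]) [t.code]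
  | leibniz φ t u =>
    exact .intro₂ (show logicLeibniz ∈ _ by simp [provability, logical])
      [φ.code, t.code, u.code, (φ.subst 0 t).code, (φ.subst 0 u).code]
      (horn_substFml 0 t φ) (horn_substFml 0 u φ)
  | @mp φ ψ _ _ ih ih' =>
    exact .intro₂ (show logicMp ∈ _ by simp [provability, logical]) [φ.code, ψ.code] ih ih'
  | @gen φ _ ih =>
    exact .intro₁ (show logicGen ∈ _ by simp [provability, logical]) [φ.code] ih

theorem horn_random {φ ψ : Fml} (hr : random φ ψ ∈ provability) {e : ℕ}
    (hφ : PAProves (φ.subst 0 (num e))) (hψ : PAProves (ψ.subst 0 (num e))) :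
    Horn provability (Nat.pair 7 e) := by
  refine .intro _ hr [e, (num e).code, (φ.subst 0 (num e)).code, (ψ.subst 0 (num e)).code] ?_
  simp only [random, List.forall_mem_cons, List.not_mem_nil, false_imp_iff, implies_true, and_true]
  exact ⟨horn_num e, horn_substFml 0 _ φ, horn_of_paProves hφ, horn_substFml 0 _ ψ,
    horn_of_paProves hψ⟩

end Complete

theorem horn_iff_provablyRandom {e : ℕ} :
    Horn Clause.provability (Nat.pair 7 e) ↔ ProvablyRandom e := by
  refine ⟨fun h => (holds_random e).1 h.holds, ?_⟩
  rintro ⟨h₁, h₂ | h₂⟩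
  · exact horn_random (by simp [Clause.provability]) h₁ h₂
  · exact horn_random (by simp [Clause.provability]) h₁ h₂

/-- The set of provably random indices has a primitive recursive enumeration. -/
theorem exists_primrec_enum_provablyRandom :
    ∃ f : ℕ → Option ℕ, Primrec f ∧ ∀ e, (∃ i, f i = some e) ↔ ProvablyRandom e := by
  obtain ⟨f, hf, h⟩ := exists_primrec_enum_horn Clause.provability 7
  exact ⟨f, hf, fun e => (h e).trans horn_iff_provablyRandom⟩

/-! ## Bit strings -/

/-- The inverse of `strNum`. -/
def strOf : ℕ → List Bool
  | 0 => []
  | n + 1 => strOf (n / 2) ++ [decide (n % 2 = 1)]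

/-- The last bit is the parity of the predecessor of the number and the remaining string is its
half; hence the inductions from the right end. -/
theorem strNum_concat (s : List Bool) (b : Bool) :
    strNum (s ++ [b]) = 2 * strNum s + 1 + b.toNat := by
  simp [strNum]

@[simp] theorem strNum_strOf (n : ℕ) : strNum (strOf n) = n := by
  induction n using Nat.strong_induction_on with
  | _ n ih =>
    cases n with
    | zero => simp [strOf, strNum]
    | succ n =>
      rw [strOf, strNum_concat, ih _ (by omega)]
      rcases Nat.mod_two_eq_zero_or_one n with h | h <;> simp [h] <;> omega

@[simp] theorem strOf_strNum (s : List Bool) : strOf (strNum s) = s := by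
  induction s using List.reverseRecOn with
  | nil => simp [strOf, strNum]
  | append_singleton s b ih =>
    rw [strNum_concat, Nat.add_right_comm, strOf]
    cases b
    · rw [show (2 * strNum s + false.toNat) / 2 = strNum s by simp, ih]
      simp
    · rw [show (2 * strNum s + true.toNat) / 2 = strNum s by simp; omega, ih]
      simp

theorem strNum_injective : Function.Injective strNum :=
  Function.LeftInverse.injective strOf_strNum

theorem length_le_strNum (s : List Bool) : s.length ≤ strNum s := by
  induction s using List.reverseRecOn with
  | nil => simp
  | append_singleton s b ih =>
    rw [strNum_concat, List.length_append, List.length_singleton]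
    omega

theorem primrec_strNum : Primrec strNum :=
  Primrec.list_foldl (h := fun _ (z : ℕ × Bool) => 2 * z.1 + 1 + z.2.toNat) Primrec.id (Primrec.const 0)
    (Primrec.nat_add.comp (Primrec.nat_double_succ.comp (Primrec.fst.comp Primrec.snd))
      ((Primrec.dom_bool _).comp (Primrec.snd.comp Primrec.snd)))

theorem primrec_strOf : Primrec strOf := by
  have hpred : Primrec fun p : Unit × List (List Bool) => p.2.length - 1 :=
    Primrec.nat_sub.comp (Primrec.list_length.comp Primrec.snd) (Primrec.const 1)
  have hbit : Primrec fun p : Unit × List (List Bool) => decide ((p.2.length - 1) % 2 = 1) :=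
    (Primrec.eq.comp (Primrec.nat_mod.comp hpred (Primrec.const 2)) (Primrec.const 1)).decide
  -- Course-of-values recursion: `l` lists the earlier values, so its length is the current
  -- argument.
  have hg : Primrec₂ fun (_ : Unit) (l : List (List Bool)) =>
      if l.length = 0 then some [] else
        some (l.getD ((l.length - 1) / 2) [] ++ [decide ((l.length - 1) % 2 = 1)]) :=
    Primrec.ite (Primrec.eq.comp (Primrec.list_length.comp Primrec.snd) (Primrec.const 0))
      (Primrec.const _)
      (Primrec.option_some.comp (Primrec.list_append.comp
        ((Primrec.list_getD []).comp Primrec.snd (Primrec.nat_div.comp hpred (Primrec.const 2)))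
        (Primrec.list_cons.comp hbit (Primrec.const []))))
  refine ((Primrec.nat_strong_rec (fun _ n => strOf n) hg fun _ n => ?_).comp
    (Primrec.const ()) Primrec.id)
  cases n with
  | zero => simp [strOf]
  | succ n =>
    have : n / 2 < n + 1 := by omega
    simp [strOf, this]

theorem primrecRel_prefix : PrimrecRel fun s t : List Bool => s <+: t :=
  (Primrec.eq.comp (Primrec.list_take.comp (Primrec.list_length.comp Primrec.fst) Primrec.snd)
    Primrec.fst).of_eq fun z => by
      change _ ↔ z.1 <+: z.2
      rw [List.prefix_iff_eq_take]
      exact eq_comm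

theorem halts_iff {e : ℕ} {s : List Bool} : Halts e s ↔ ∃ y, y ∈ prog e (strNum s) :=
  ⟨fun ⟨t, h⟩ => ⟨_, h⟩, fun ⟨y, h⟩ => ⟨strOf y, by rwa [Outputs, strNum_strOf]⟩⟩

/-! ## Kraft's inequality -/

/-- The bit strings of length `N`. -/
def words (N : ℕ) : Finset (List Bool) :=
  (Finset.univ : Finset (List.Vector Bool N)).image List.Vector.toList

@[simp] theorem mem_words {N : ℕ} {s : List Bool} : s ∈ words N ↔ s.length = N := by
  simp only [words, Finset.mem_image, Finset.mem_univ, true_and]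
  exact ⟨fun ⟨w, h⟩ => h ▸ w.toList_length, fun h => ⟨⟨s, h⟩, rfl⟩⟩

@[simp] theorem card_words (N : ℕ) : (words N).card = 2 ^ N := by
  rw [words, Finset.card_image_of_injective _ List.Vector.toList_injective, Finset.card_univ, card_vector, Fintype.card_bool]

/-- An extension of `d` to length `N` is `d` followed by an arbitrary word of the missing length. -/
theorem card_filter_prefix_words {N : ℕ} {d : List Bool} (h : d.length ≤ N) :
    ((words N).filter (d <+: ·)).card = 2 ^ (N - d.length) := by
  have : (words N).filter (d <+: ·) = (words (N - d.length)).image (d ++ ·) := by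
    ext w
    simp only [Finset.mem_filter, mem_words, Finset.mem_image]
    constructor
    · rintro ⟨hw, u, rfl⟩
      exact ⟨u, by simp at hw; omega, rfl⟩
    · rintro ⟨u, hu, rfl⟩
      exact ⟨by simp; omega, List.prefix_append _ _⟩
  rw [this, Finset.card_image_of_injective _ (List.append_right_injective d), card_words]

def PrefixFree (S : Set (List Bool)) : Prop := ∀ s ∈ S, ∀ t ∈ S, s <+: t → s = t

/-- Two prefixes of one word are comparable, so different members of `S` have disjoint sets of
extensions. The exact count, and not only Kraft's inequality, is needed to recognize halting
probability `1`. -/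
theorem PrefixFree.sum_two_pow {S : Finset (List Bool)} (hS : PrefixFree (S : Set (List Bool)))
    {N : ℕ} (hN : ∀ s ∈ S, s.length ≤ N) :
    ∑ s ∈ S, 2 ^ (N - s.length) = ((words N).filter fun w => ∃ d ∈ S, d <+: w).card := by
  have : ((words N).filter fun w => ∃ d ∈ S, d <+: w) =
      S.biUnion fun d => (words N).filter (d <+: ·) := by
    ext w
    simp only [Finset.mem_filter, Finset.mem_biUnion]
    tauto
  rw [this, Finset.card_biUnion]
  · exact Finset.sum_congr rfl fun s hs => (card_filter_prefix_words (hN s hs)).symm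
  · intro s hs t ht hst
    rw [Function.onFun, Finset.disjoint_left]
    intro w hw hw'
    rw [Finset.mem_filter] at hw hw'
    rcases List.prefix_or_prefix_of_prefix hw.2 hw'.2 with h | h
    · exact hst (hS s hs t ht h)
    · exact hst (hS t ht s hs h).symm

theorem sum_half_pow {S : Finset (List Bool)} {N : ℕ} (hN : ∀ s ∈ S, s.length ≤ N) :
    ∑ s ∈ S, (1 / 2 : ℝ) ^ s.length = (∑ s ∈ S, 2 ^ (N - s.length) : ℕ) / 2 ^ N := by
  push_cast
  rw [Finset.sum_div]
  refine Finset.sum_congr rfl fun s hs => ?_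
  rw [eq_div_iff (by positivity), one_div, inv_pow, inv_mul_eq_iff_eq_mul₀ (by positivity),
    ← pow_add, Nat.add_sub_cancel' (hN s hs)]

theorem PrefixFree.sum_two_pow_le {S : Finset (List Bool)}
    (hS : PrefixFree (S : Set (List Bool))) {N : ℕ} (hN : ∀ s ∈ S, s.length ≤ N) :
    ∑ s ∈ S, 2 ^ (N - s.length) ≤ 2 ^ N := by
  rw [hS.sum_two_pow hN, ← card_words N]
  exact Finset.card_filter_le _ _

theorem PrefixFree.sum_half_pow_le {S : Finset (List Bool)}
    (hS : PrefixFree (S : Set (List Bool))) : ∑ s ∈ S, (1 / 2 : ℝ) ^ s.length ≤ 1 := by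
  have hN : ∀ s ∈ S, s.length ≤ S.sup List.length := fun s hs => Finset.le_sup hs
  rw [sum_half_pow hN, div_le_one (by positivity)]
  exact_mod_cast hS.sum_two_pow_le hN

theorem prefixFree_of_isMachine {e : ℕ} (he : IsMachine e) {S : Set (List Bool)}
    (hS : ∀ s ∈ S, Halts e s) : PrefixFree S :=
  fun s hs t ht h => he s t (hS s hs) (hS t ht) h

/-! ## Halting probabilities as computably enumerable reals -/

theorem sum_subtype_le_one {e : ℕ} (he : IsMachine e) (F : Finset {s // Halts e s}) :
    ∑ s ∈ F, (1 / 2 : ℝ) ^ s.1.length ≤ 1 := by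
  have hP : PrefixFree ((F.map (Function.Embedding.subtype _) : Finset (List Bool)) :
      Set (List Bool)) := prefixFree_of_isMachine he fun s hs => by
    simp only [Finset.coe_map, Set.mem_image] at hs
    obtain ⟨t, -, rfl⟩ := hs
    exact t.2
  simpa using hP.sum_half_pow_le

theorem summable_half_pow {e : ℕ} (he : IsMachine e) :
    Summable fun s : {s // Halts e s} => (1 / 2 : ℝ) ^ s.1.length :=
  summable_of_sum_le (fun _ => by positivity) (sum_subtype_le_one he)

theorem sum_le_Omega {e : ℕ} (he : IsMachine e) {S : Finset (List Bool)}
    (hS : ∀ s ∈ S, Halts e s) : ∑ s ∈ S, (1 / 2 : ℝ) ^ s.length ≤ Omega e := by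
  classical
  have := (summable_half_pow he).sum_le_tsum (S.subtype (Halts e)) fun _ _ => by positivity
  rwa [Finset.sum_subtype_of_mem (fun s => (1 / 2 : ℝ) ^ s.length) hS] at this

/-- A machine with a finite domain that meets every sufficiently long string has halting
probability `1`. -/
theorem Omega_eq_one {e : ℕ} (he : IsMachine e) {N : ℕ}
    (hN : ∀ s, Halts e s → s.length ≤ N)
    (hcover : ∀ w : List Bool, w.length = N → ∃ d, Halts e d ∧ d <+: w) : Omega e = 1 := by
  refine le_antisymm ((summable_half_pow he).tsum_le_of_sum_le (sum_subtype_le_one he)) ?_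
  classical
  let S : Finset (List Bool) := ((Finset.range (N + 1)).biUnion words).filter (Halts e)
  have hS : ∀ s, s ∈ S ↔ Halts e s := fun s => by
    simp only [S, Finset.mem_filter, Finset.mem_biUnion, Finset.mem_range, mem_words]
    exact ⟨fun h => h.2, fun h => ⟨⟨s.length, Nat.lt_succ_of_le (hN s h), rfl⟩, h⟩⟩
  have hSN : ∀ s ∈ S, s.length ≤ N := fun s hs => hN s ((hS s).1 hs)
  have hP : PrefixFree (S : Set (List Bool)) :=
    prefixFree_of_isMachine he fun s hs => (hS s).1 hs
  -- By the covering hypothesis the count in Kraft's inequality reaches its maximum `2 ^ N`.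
  have hall : ((words N).filter fun w => ∃ d ∈ S, d <+: w) = words N := by
    refine Finset.filter_true_of_mem fun w hw => ?_
    obtain ⟨d, hd, hdw⟩ := hcover w (mem_words.1 hw)
    exact ⟨d, (hS d).2 hd, hdw⟩
  refine le_trans (le_of_eq ?_) (sum_le_Omega he fun s hs => (hS s).1 hs)
  rw [sum_half_pow hSN, hP.sum_two_pow hSN, hall, card_words]
  push_cast
  exact (div_self (by positivity)).symm

/-- The strings on which the program is seen to halt by stage `n`. -/
def stage (c : Code) (n : ℕ) : Finset (List Bool) :=
  ((Finset.range n).filter fun m => (c.evaln n m).isSome).image strOf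

/-- Evaluation with bound `n` succeeds only on inputs below `n`, so the range in `stage` excludes
nothing. -/
theorem mem_stage {c : Code} {n : ℕ} {s : List Bool} :
    s ∈ stage c n ↔ (c.evaln n (strNum s)).isSome := by
  simp only [stage, Finset.mem_image, Finset.mem_filter, Finset.mem_range]
  constructor
  · rintro ⟨m, ⟨-, h⟩, rfl⟩
    simpa using h
  · intro h
    obtain ⟨y, hy⟩ := Option.isSome_iff_exists.1 h
    exact ⟨strNum s, ⟨Code.evaln_bound hy, h⟩, strOf_strNum s⟩

theorem length_le_of_mem_stage {c : Code} {n : ℕ} {s : List Bool} (h : s ∈ stage c n) :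
    s.length ≤ n := by
  obtain ⟨y, hy⟩ := Option.isSome_iff_exists.1 (mem_stage.1 h)
  exact (length_le_strNum s).trans (Code.evaln_bound hy).le

theorem stage_mono {c : Code} {m n : ℕ} (h : m ≤ n) : stage c m ⊆ stage c n := by
  intro s hs
  obtain ⟨y, hy⟩ := Option.isSome_iff_exists.1 (mem_stage.1 hs)
  exact mem_stage.2 (Option.isSome_iff_exists.2 ⟨y, Code.evaln_mono h hy⟩)

theorem halts_iff_exists_stage {e : ℕ} {s : List Bool} :
    Halts e s ↔ ∃ n, s ∈ stage (Denumerable.ofNat Code e) n := by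
  rw [halts_iff, prog]
  simp only [Code.evaln_complete, mem_stage, Option.isSome_iff_exists, Option.mem_def]
  exact exists_comm

/-- The numerator, over `2 ^ n`, of the measure of `stage c n`. -/
def stageSum (c : Code) (n : ℕ) : ℕ :=
  ((List.range n).map fun m =>
    if (c.evaln n m).isSome then 2 ^ (n - (strOf m).length) else 0).sum

theorem stageSum_eq (c : Code) (n : ℕ) : stageSum c n = ∑ s ∈ stage c n, 2 ^ (n - s.length) := by
  rw [stage, Finset.sum_image fun a _ b _ h => by simpa using congrArg strNum h,
    Finset.sum_filter]
  rfl

theorem primrec_two_pow : Primrec fun n : ℕ => 2 ^ n :=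
  (Primrec₂.unpaired'.1 Nat.Primrec.pow).comp (Primrec.const 2) Primrec.id

theorem primrec₂_stageSum : Primrec₂ stageSum := by
  have hterm : Primrec₂ fun (z : Code × ℕ) (m : ℕ) =>
      if (z.1.evaln z.2 m).isSome then 2 ^ (z.2 - (strOf m).length) else 0 := by
    have hev : Primrec fun w : (Code × ℕ) × ℕ => w.1.1.evaln w.1.2 w.2 :=
      Code.primrec_evaln.comp (Primrec.pair (Primrec.pair (Primrec.snd.comp Primrec.fst)
        (Primrec.fst.comp Primrec.fst)) Primrec.snd)
    exact Primrec.ite (Primrec.eq.comp (Primrec.option_isSome.comp hev) (Primrec.const true))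
      (primrec_two_pow.comp (Primrec.nat_sub.comp (Primrec.snd.comp Primrec.fst)
        (Primrec.list_length.comp (primrec_strOf.comp Primrec.snd)))) (Primrec.const 0)
  have hsum : Primrec fun l : List ℕ => l.sum :=
    (Primrec.list_foldr (h := fun _ z => z.1 + z.2) Primrec.id (Primrec.const 0)
      (Primrec.nat_add.comp (Primrec.fst.comp Primrec.snd) (Primrec.snd.comp Primrec.snd))).of_eq
      fun l => rfl
  exact hsum.comp (Primrec.list_map (Primrec.list_range.comp Primrec.snd) hterm)

theorem ceReal_eq_Omega {e e' : ℕ} (he : IsMachine e)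
    (h : ∀ n, prog e' n =
      Part.some (Nat.pair (stageSum (Denumerable.ofNat Code e) n) (2 ^ n - 1))) :
    ceReal e' = Omega e := by
  set c := Denumerable.ofNat Code e
  have hhalt : ∀ n, ∀ s ∈ stage c n, Halts e s := fun n s hs =>
    halts_iff_exists_stage.2 ⟨n, hs⟩
  have hlen : ∀ n, ∀ s ∈ stage c n, s.length ≤ n := fun n s hs => length_le_of_mem_stage hs
  have hpow : ∀ n : ℕ, 2 ^ n - 1 + 1 = 2 ^ n := fun n => Nat.sub_add_cancel Nat.one_le_two_pow
  have hval : ∀ n : ℕ, (stageSum c n : ℝ) / ((2 ^ n - 1 : ℕ) + 1) =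
      ∑ s ∈ stage c n, (1 / 2 : ℝ) ^ s.length := fun n => by
    rw [sum_half_pow (hlen n), stageSum_eq]
    congr 1
    exact_mod_cast hpow n
  have hset : {x : ℝ | ∃ a b, Lists e' a b ∧ x = a / (b + 1)} =
      Set.range fun n => ∑ s ∈ stage c n, (1 / 2 : ℝ) ^ s.length := by
    ext x
    constructor
    · rintro ⟨a, b, ⟨-, n, hn⟩, rfl⟩
      rw [h, Part.mem_some_iff, Nat.pair_eq_pair] at hn
      obtain ⟨rfl, rfl⟩ := hn
      exact ⟨n, (hval n).symm⟩
    · rintro ⟨n, rfl⟩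
      refine ⟨stageSum c n, 2 ^ n - 1, ⟨?_, n, by rw [h]; exact Part.mem_some _⟩, (hval n).symm⟩
      -- Kraft's inequality keeps the stage sums in the unit interval, so `Lists` does not discard
      -- them.
      rw [hpow, stageSum_eq]
      exact (prefixFree_of_isMachine he (hhalt n)).sum_two_pow_le (hlen n)
  have hle : ∀ n, ∑ s ∈ stage c n, (1 / 2 : ℝ) ^ s.length ≤ Omega e := fun n =>
    sum_le_Omega he (hhalt n)
  rw [ceReal, hset]
  refine le_antisymm (ciSup_le hle) ((summable_half_pow he).tsum_le_of_sum_le fun F => ?_)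
  -- A finite part of the domain is contained in a single stage.
  obtain ⟨n, hn⟩ : ∃ n, ∀ s ∈ F, s.1 ∈ stage c n := by
    choose g hg using fun s : {s // Halts e s} => halts_iff_exists_stage.1 s.2
    exact ⟨F.sup g, fun s hs => stage_mono (Finset.le_sup hs) (hg s)⟩
  refine le_trans ?_ (le_ciSup (f := fun n => ∑ s ∈ stage c n, (1 / 2 : ℝ) ^ s.length)
    ⟨_, Set.forall_mem_range.2 hle⟩ n)
  rw [show ∑ s ∈ F, (1 / 2 : ℝ) ^ s.1.length =
    ∑ s ∈ F.map (Function.Embedding.subtype _), (1 / 2 : ℝ) ^ s.length by simp]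
  refine Finset.sum_le_sum_of_subset_of_nonneg (fun s hs => ?_) fun _ _ _ => by positivity
  obtain ⟨t, ht, rfl⟩ := Finset.mem_map.1 hs
  exact hn t ht

/-- Halting probabilities are, effectively, computably enumerable reals. -/
theorem exists_representsOmega : ∃ r : ℕ → ℕ, RepresentsOmega r := by
  have hF : Primrec fun z : ℕ => Nat.pair (stageSum (Denumerable.ofNat Code z.unpair.1) z.unpair.2)
      (2 ^ z.unpair.2 - 1) := by
    have h₂ : Primrec fun z : ℕ => z.unpair.2 := Primrec.snd.comp Primrec.unpair
    exact Primrec₂.natPair.comp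
      (primrec₂_stageSum.comp ((Primrec.ofNat Code).comp (Primrec.fst.comp Primrec.unpair)) h₂)
      (Primrec.nat_sub.comp (primrec_two_pow.comp h₂) (Primrec.const 1))
  obtain ⟨c, hc⟩ := Code.exists_code.1 (Partrec.nat_iff.1 hF.to_comp.partrec)
  -- The s-m-n theorem: `e` is built into the program that lists the stage sums.
  refine ⟨fun e => Encodable.encode (c.curry e), ?_, fun e he => ceReal_eq_Omega he fun n => ?_⟩
  · exact (Primrec.encode.comp
      (Code.primrec₂_curry.comp (Primrec.const c) Primrec.id)).to_comp
  · rw [prog, Denumerable.ofNat_encode, Code.eval_curry, hc]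
    simp

/-! ## A universal prefix-free machine -/

/-- The least number that satisfies `p`. -/
def firstStage (p : ℕ → Bool) : Part ℕ := Nat.rfind fun k => Part.some (p k)

theorem mem_firstStage {p : ℕ → Bool} {k : ℕ} :
    k ∈ firstStage p ↔ p k = true ∧ ∀ j < k, p j = false := by
  refine Nat.mem_rfind.trans (and_congr ?_ ⟨fun h j hj => ?_, fun h j hj => ?_⟩)
  · exact Part.mem_some_iff.trans eq_comm
  · exact (Part.mem_some_iff.1 (h hj)).symm
  · exact Part.mem_some_iff.2 (h j hj).symm

theorem partrec_firstStage {α : Type*} [Primcodable α] {p : α → ℕ → Bool} (hp : Primrec₂ p) :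
    Partrec fun a => firstStage (p a) :=
  Partrec.rfind hp.to_comp.partrec₂

theorem primrec_evaln_isSome {α : Type*} [Primcodable α] {c : α → Code} {k m : α → ℕ}
    (hc : Primrec c) (hk : Primrec k) (hm : Primrec m) :
    PrimrecPred fun a => ((c a).evaln (k a) (m a)).isSome :=
  Primrec.eq.comp (Primrec.option_isSome.comp
    (Code.primrec_evaln.comp (Primrec.pair (Primrec.pair hk hc) hm))) (Primrec.const true)

/-- By stage `k` the program is seen to halt on another string comparable to the one with
number `m`. -/
abbrev Conflict (c : Code) (k m : ℕ) : Prop :=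
  ∃ m' < k, (c.evaln k m').isSome ∧ m' ≠ m ∧
    (strOf m' <+: strOf m ∨ strOf m <+: strOf m')

theorem primrecPred_conflict : PrimrecPred fun z : (Code × ℕ) × ℕ => Conflict z.1.1 z.2 z.1.2 := by
  have hm : Primrec fun w : ℕ × (Code × ℕ) × ℕ => w.2.1.2 :=
    Primrec.snd.comp (Primrec.fst.comp Primrec.snd)
  have h : PrimrecRel fun (m' : ℕ) (z : (Code × ℕ) × ℕ) => (z.1.1.evaln z.2 m').isSome ∧
      m' ≠ z.1.2 ∧ (strOf m' <+: strOf z.1.2 ∨ strOf z.1.2 <+: strOf m') :=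
    (primrec_evaln_isSome (Primrec.fst.comp (Primrec.fst.comp Primrec.snd))
      (Primrec.snd.comp Primrec.snd) Primrec.fst).and
      ((Primrec.eq.comp Primrec.fst hm).not.and
        ((primrecRel_prefix.comp (primrec_strOf.comp Primrec.fst) (primrec_strOf.comp hm)).or
          (primrecRel_prefix.comp (primrec_strOf.comp hm) (primrec_strOf.comp Primrec.fst))))
  exact (h.exists_mem_list.comp (Primrec.list_range.comp Primrec.snd) Primrec.id).of_eq
    fun z => by simp [Conflict]

/-- Run a program, but diverge if a conflict is seen when it halts. -/
def prefixFreeRun (c : Code) (m : ℕ) : Part ℕ :=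
  (firstStage fun k => (c.evaln k m).isSome).bind fun k =>
    ((if Conflict c k m then none else c.evaln k m : Option ℕ) : Part ℕ)

theorem partrec₂_prefixFreeRun : Partrec₂ prefixFreeRun := by
  have hev : Primrec fun w : (Code × ℕ) × ℕ => w.1.1.evaln w.2 w.1.2 :=
    Code.primrec_evaln.comp (Primrec.pair (Primrec.pair Primrec.snd (Primrec.fst.comp Primrec.fst))
      (Primrec.snd.comp Primrec.fst))
  refine Partrec.bind (partrec_firstStage (p := fun (z : Code × ℕ) k =>
    (z.1.evaln k z.2).isSome) ?_) ?_
  · exact Primrec.option_isSome.comp hev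
  · exact (Primrec.ite primrecPred_conflict (Primrec.const none) hev).to_comp.ofOption

theorem mem_prefixFreeRun {c : Code} {m y : ℕ} : y ∈ prefixFreeRun c m ↔
    ∃ k, y ∈ c.evaln k m ∧ (∀ j < k, c.evaln j m = none) ∧ ¬ Conflict c k m := by
  simp only [prefixFreeRun, Part.mem_bind_iff, mem_firstStage, Part.mem_coe]
  constructor
  · rintro ⟨k, ⟨-, h₁⟩, h₂⟩
    split_ifs at h₂ with h
    · simp at h₂
    · exact ⟨k, h₂, fun j hj => by simpa using h₁ j hj, h⟩
  · rintro ⟨k, h₁, h₂, h₃⟩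
    refine ⟨k, ⟨?_, fun j hj => ?_⟩, by rwa [if_neg h₃]⟩
    · rw [Option.mem_def] at h₁
      simp [h₁]
    · simp [h₂ j hj]

/-- Of two different comparable strings, the one that halts no earlier sees the other halt and
diverges. -/
theorem prefixFreeRun_prefixFree {c : Code} {s t : List Bool}
    (hs : (prefixFreeRun c (strNum s)).Dom) (ht : (prefixFreeRun c (strNum t)).Dom)
    (hst : s <+: t) : s = t := by
  obtain ⟨y, hy⟩ := Part.dom_iff_mem.1 hs
  obtain ⟨z, hz⟩ := Part.dom_iff_mem.1 ht
  obtain ⟨k, hk, -, hkc⟩ := mem_prefixFreeRun.1 hy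
  obtain ⟨l, hl, -, hlc⟩ := mem_prefixFreeRun.1 hz
  by_contra hne
  have hne' : strNum s ≠ strNum t := fun h => hne (strNum_injective h)
  rcases le_total k l with h | h
  · have hk' := Code.evaln_mono h hk
    refine hlc ⟨strNum s, Code.evaln_bound hk', ?_, hne', by simp [hst]⟩
    rw [Option.mem_def.1 hk']
    rfl
  · have hl' := Code.evaln_mono h hl
    refine hkc ⟨strNum t, Code.evaln_bound hl', ?_, hne'.symm, by simp [hst]⟩
    rw [Option.mem_def.1 hl']
    rfl

/-- A conflict would exhibit two comparable halting inputs, so the check never changes a genuine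
machine. -/
theorem mem_prefixFreeRun_of_isMachine {e : ℕ} (he : IsMachine e) {m y : ℕ}
    (h : y ∈ prog e m) : y ∈ prefixFreeRun (Denumerable.ofNat Code e) m := by
  set c := Denumerable.ofNat Code e
  have hex : ∃ k, (c.evaln k m).isSome := by
    obtain ⟨k, hk⟩ := Code.evaln_complete.1 h
    exact ⟨k, Option.isSome_iff_exists.2 ⟨y, hk⟩⟩
  classical
  obtain ⟨z, hz⟩ := Option.isSome_iff_exists.1 (Nat.find_spec hex)
  obtain rfl : z = y := Part.mem_unique (Code.evaln_sound hz) h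
  refine mem_prefixFreeRun.2 ⟨Nat.find hex, hz, fun j hj => ?_, ?_⟩
  · simpa using Nat.find_min hex hj
  · rintro ⟨m', -, hm', hne, hcomp⟩
    obtain ⟨w, hw⟩ := Option.isSome_iff_exists.1 hm'
    have h₁ : Halts e (strOf m) := halts_iff.2 ⟨z, by simpa using h⟩
    have h₂ : Halts e (strOf m') := halts_iff.2 ⟨w, by
      rw [strNum_strOf]
      exact Code.evaln_sound hw⟩
    have : strOf m' = strOf m :=
      hcomp.elim (fun h => he _ _ h₂ h₁ h) fun h => (he _ _ h₁ h₂ h).symm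
    exact hne (by simpa using congrArg strNum this)

/-- Read a string as `0 ^ i 1 s`. -/
def parse : List Bool → Option (ℕ × List Bool)
  | [] => none
  | true :: s => some (0, s)
  | false :: s => (parse s).map fun z => (z.1 + 1, z.2)

theorem primrec_parse : Primrec parse := by
  have hmap : Primrec fun o : Option (ℕ × List Bool) => o.map fun z => (z.1 + 1, z.2) :=
    Primrec.option_map₁ (Primrec.pair (Primrec.succ.comp Primrec.fst) Primrec.snd)
  have h : Primrec fun w : Bool × List Bool × Option (ℕ × List Bool) =>
      bif w.1 then some (0, w.2.1) else w.2.2.map fun z => (z.1 + 1, z.2) :=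
    Primrec.cond Primrec.fst (Primrec.option_some.comp (Primrec.pair (Primrec.const 0)
      (Primrec.fst.comp Primrec.snd))) (hmap.comp (Primrec.snd.comp Primrec.snd))
  refine (Primrec.list_rec (f := fun l : List Bool => l) (g := fun _ => none)
    (h := fun _ (w : Bool × List Bool × Option (ℕ × List Bool)) => bif w.1 then some (0, w.2.1) else
      w.2.2.map fun z : ℕ × List Bool => (z.1 + 1, z.2)) Primrec.id (Primrec.const none) (h.comp Primrec.snd)).of_eq fun l => ?_
  induction l with
  | nil => rfl
  | cons b l ih => cases b <;> simp_all [parse]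

theorem parse_eq_some {l : List Bool} {i : ℕ} {s : List Bool} :
    parse l = some (i, s) ↔ l = List.replicate i false ++ true :: s := by
  induction l generalizing i with
  | nil => simp [parse]
  | cons b l ih =>
    cases b
    · cases i with
      | zero => simp [parse]
      | succ i => simp [parse, List.replicate_succ, ← ih]
    · cases i with
      | zero => simp [parse, eq_comm]
      | succ i => simp [parse, List.replicate_succ]

/-- The universal machine: on input `0 ^ i 1 s`, run the prefix-free version of program `i`
on `s`. -/
def universalRun (m : ℕ) : Part ℕ :=
  (parse (strOf m) : Part (ℕ × List Bool)).bind fun z =>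
    prefixFreeRun (Denumerable.ofNat Code z.1) (strNum z.2)

theorem partrec_universalRun : Partrec universalRun :=
  Partrec.bind (primrec_parse.comp primrec_strOf).to_comp.ofOption
    (partrec₂_prefixFreeRun.comp
      ((Primrec.ofNat Code).comp (Primrec.fst.comp Primrec.snd)).to_comp
      (primrec_strNum.comp (Primrec.snd.comp Primrec.snd)).to_comp)

theorem mem_universalRun {l : List Bool} {y : ℕ} : y ∈ universalRun (strNum l) ↔
    ∃ i s, l = List.replicate i false ++ true :: s ∧
      y ∈ prefixFreeRun (Denumerable.ofNat Code i) (strNum s) := by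
  simp [universalRun, parse_eq_some]

/-- The header `0 ^ i 1` is self-delimiting, so comparable inputs run the same program on comparable
strings. Any program for `universalRun` is allowed because the final machine is a fixed point, not
the original code. -/
theorem isUniversal_of_prog_eq {u : ℕ} (h : ∀ m, prog u m = universalRun m) : IsUniversal u := by
  constructor
  · intro l l' hl hl' hpre
    obtain ⟨y, hy⟩ := halts_iff.1 hl
    obtain ⟨z, hz⟩ := halts_iff.1 hl'
    rw [h] at hy hz
    obtain ⟨i, s, rfl, hs⟩ := mem_universalRun.1 hy
    obtain ⟨j, t, rfl, ht⟩ := mem_universalRun.1 hz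
    obtain ⟨rfl, hst⟩ : i = j ∧ s <+: t := by
      clear hl hl' hy hz hs ht
      induction i generalizing j with
      | zero =>
        cases j with
        | zero => simpa using hpre
        | succ j => simp [List.replicate_succ] at hpre
      | succ i ih =>
        cases j with
        | zero => simp [List.replicate_succ] at hpre
        | succ j =>
          obtain ⟨h₁, h₂⟩ := ih j (by simpa [List.replicate_succ] using hpre)
          exact ⟨congrArg _ h₁, h₂⟩
    rw [prefixFreeRun_prefixFree (Part.dom_iff_mem.2 ⟨y, hs⟩) (Part.dom_iff_mem.2 ⟨z, ht⟩) hst]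
  · intro e he
    -- The constant is the length of the header: `e` zeros and a one.
    refine ⟨e + 1, fun s t hst => ⟨List.replicate e false ++ true :: s, ?_, ?_⟩⟩
    · rw [Outputs, h]
      exact mem_universalRun.2 ⟨e, s, rfl, mem_prefixFreeRun_of_isMachine he hst⟩
    · simp
      omega

theorem exists_universal_code : ∃ c : Code, c.eval = universalRun :=
  Code.exists_code.1 (Partrec.nat_iff.1 partrec_universalRun)

/-! ## Spoiling a machine that is enumerated -/

/-- The string with number `m` has length `k` and no prefix on which the program is seen to halt
by stage `k`. -/
abbrev Fills (c : Code) (k m : ℕ) : Prop :=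
  (strOf m).length = k ∧ ∀ m' < k, (c.evaln k m').isSome → ¬ strOf m' <+: strOf m

/-- Run program `c` until `f` enumerates `ρ`, say at stage `k`; then extend the strings found so
far to a maximal prefix-free set by strings of length `k`. -/
def spoiledRun (c : Code) (f : ℕ → Option ℕ) (ρ m : ℕ) : Part ℕ :=
  (firstStage fun k => (c.evaln k m).isSome || decide (f k = some ρ)).bind fun k =>
    ((c.evaln k m <|> if Fills c k m then some 0 else none : Option ℕ) : Part ℕ)

theorem primrecPred_fills (c : Code) : PrimrecPred fun z : ℕ × ℕ => Fills c z.2 z.1 := by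
  have h : PrimrecRel fun (m' : ℕ) (z : ℕ × ℕ) =>
      ¬ (c.evaln z.2 m').isSome ∨ ¬ strOf m' <+: strOf z.1 :=
    (primrec_evaln_isSome (Primrec.const c) (Primrec.snd.comp Primrec.snd) Primrec.fst).not.or
      (primrecRel_prefix.comp (primrec_strOf.comp Primrec.fst)
        (primrec_strOf.comp (Primrec.fst.comp Primrec.snd))).not
  exact ((Primrec.eq.comp (Primrec.list_length.comp (primrec_strOf.comp Primrec.fst))
    Primrec.snd).and (h.forall_mem_list.comp (Primrec.list_range.comp Primrec.snd)
      Primrec.id)).of_eq fun z => by simp only [Fills, imp_iff_not_or, List.mem_range, id]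

theorem partrec₂_spoiledRun (c : Code) {f : ℕ → Option ℕ} (hf : Primrec f) :
    Partrec₂ (spoiledRun c f) := by
  have hev : Primrec fun w : (ℕ × ℕ) × ℕ => c.evaln w.2 w.1.2 :=
    Code.primrec_evaln.comp (Primrec.pair (Primrec.pair Primrec.snd (Primrec.const c))
      (Primrec.snd.comp Primrec.fst))
  refine Partrec.bind (partrec_firstStage (p := fun (z : ℕ × ℕ) k =>
    (c.evaln k z.2).isSome || decide (f k = some z.1)) ?_) ?_
  · exact Primrec.or.comp (Primrec.option_isSome.comp hev)
      (Primrec.eq.comp (hf.comp Primrec.snd) (Primrec.option_some.comp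
        (Primrec.fst.comp Primrec.fst))).decide
  · exact (Primrec.option_orElse.comp hev (Primrec.ite ((primrecPred_fills c).comp
      (Primrec.pair (Primrec.snd.comp Primrec.fst) Primrec.snd)) (Primrec.const (some 0))
      (Primrec.const none))).to_comp.ofOption

theorem spoiledRun_eq {c : Code} {f : ℕ → Option ℕ} {ρ : ℕ} (h : ∀ k, f k ≠ some ρ) (m : ℕ) :
    spoiledRun c f ρ m = c.eval m := by
  have hr : ∀ {k}, k ∈ (firstStage fun k => (c.evaln k m).isSome ||
      decide (f k = some ρ)) ↔ (c.evaln k m).isSome ∧ ∀ j < k, c.evaln j m = none := by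
    intro k
    rw [mem_firstStage]
    simp [h]
  ext y
  simp only [spoiledRun, Part.mem_bind_iff, hr, Part.mem_coe, Option.mem_def]
  constructor
  · rintro ⟨k, ⟨hk, -⟩, hy⟩
    obtain ⟨z, hz⟩ := Option.isSome_iff_exists.1 hk
    rw [hz] at hy
    obtain rfl : z = y := by simpa using hy
    exact Code.evaln_sound hz
  · intro hy
    have hex : ∃ k, (c.evaln k m).isSome := by
      obtain ⟨k, hk⟩ := Code.evaln_complete.1 hy
      exact ⟨k, Option.isSome_iff_exists.2 ⟨y, hk⟩⟩
    classical
    obtain ⟨z, hz⟩ := Option.isSome_iff_exists.1 (Nat.find_spec hex)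
    obtain rfl : z = y := Part.mem_unique (Code.evaln_sound hz) hy
    exact ⟨Nat.find hex, ⟨Nat.find_spec hex, fun j hj => by simpa using Nat.find_min hex hj⟩,
      by simp [hz]⟩

/-- The domain of the spoiled program when `f` enumerates `ρ` for the first time at `k`. -/
theorem dom_spoiledRun {c : Code} {f : ℕ → Option ℕ} {ρ k : ℕ} (hk : f k = some ρ)
    (hmin : ∀ j < k, f j ≠ some ρ) (m : ℕ) :
    (spoiledRun c f ρ m).Dom ↔ (c.evaln k m).isSome ∨ Fills c k m := by
  have hr : ∀ {l}, l ∈ (firstStage fun k => (c.evaln k m).isSome ||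
      decide (f k = some ρ)) ↔ ((c.evaln l m).isSome ∨ f l = some ρ) ∧
      ∀ j < l, c.evaln j m = none ∧ f j ≠ some ρ := by
    intro l
    rw [mem_firstStage]
    simp
  simp only [Part.dom_iff_mem, spoiledRun, Part.mem_bind_iff, hr, Part.mem_coe, Option.mem_def]
  constructor
  · rintro ⟨y, l, ⟨h₁, h₂⟩, hy⟩
    -- The search ends by stage `k`. If it ends by halting, that is still visible at `k`; otherwise
    -- it ends exactly at `k` and the input is a filler.
    have hlk : l ≤ k := not_lt.1 fun h => (h₂ k h).2 hk
    rcases hz : c.evaln l m with - | z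
    · have hfl : f l = some ρ := by simpa [hz] using h₁
      obtain rfl : l = k := hlk.eq_of_not_lt fun h => hmin l h hfl
      right
      by_contra hF
      simp [hz, hF] at hy
    · left
      exact Option.isSome_iff_exists.2 ⟨z, Code.evaln_mono hlk hz⟩
  · intro h
    by_cases hs : (c.evaln k m).isSome
    · have hex : ∃ k, (c.evaln k m).isSome := ⟨k, hs⟩
      classical
      obtain ⟨z, hz⟩ := Option.isSome_iff_exists.1 (Nat.find_spec hex)
      exact ⟨z, Nat.find hex, ⟨.inl (Nat.find_spec hex), fun j hj =>
        ⟨by simpa using Nat.find_min hex hj, hmin j (hj.trans_le (Nat.find_le hs))⟩⟩,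
        by simp [hz]⟩
    · have hF := h.resolve_left hs
      have hn : c.evaln k m = none := by simpa using hs
      refine ⟨0, k, ⟨.inr hk, fun j hj => ⟨?_, hmin j hj⟩⟩, by rw [hn, if_pos hF]; rfl⟩
      by_contra hne
      obtain ⟨z, hz⟩ := Option.ne_none_iff_exists'.1 hne
      have := Code.evaln_mono hj.le (Option.mem_def.2 hz)
      simp [hn] at this

/-- A spoiled prefix-free machine is still prefix-free, and has halting probability `1`. -/
theorem Omega_spoiled_eq_one {u t k : ℕ} (hu : IsMachine u)
    (ht : ∀ s, Halts t s ↔ s ∈ stage (Denumerable.ofNat Code u) k ∨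
      Fills (Denumerable.ofNat Code u) k (strNum s)) : IsMachine t ∧ Omega t = 1 := by
  set c := Denumerable.ofNat Code u
  have hfills : ∀ s, Fills c k (strNum s) ↔ s.length = k ∧ ∀ d ∈ stage c k, ¬ d <+: s := by
    intro s
    rw [Fills, strOf_strNum]
    refine and_congr_right fun _ => ⟨fun h d hd => ?_, fun h m _ hm' => ?_⟩
    · obtain ⟨y, hy⟩ := Option.isSome_iff_exists.1 (mem_stage.1 hd)
      simpa using h (strNum d) (Code.evaln_bound hy) (mem_stage.1 hd)
    · exact h _ (mem_stage.2 (by simpa using hm'))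
  -- The strict inequality matters: a filler, of length `k`, cannot be a prefix of an old string.
  have hlen : ∀ s ∈ stage c k, s.length < k := fun s hs => by
    obtain ⟨y, hy⟩ := Option.isSome_iff_exists.1 (mem_stage.1 hs)
    exact (length_le_strNum s).trans_lt (Code.evaln_bound hy)
  simp only [hfills] at ht
  have hM : IsMachine t := by
    intro s s' hs hs' hpre
    rcases (ht s).1 hs with h | h <;> rcases (ht s').1 hs' with h' | h'
    · exact hu s s' (halts_iff_exists_stage.2 ⟨k, h⟩) (halts_iff_exists_stage.2 ⟨k, h'⟩) hpre
    · exact absurd hpre (h'.2 s h)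
    · exact absurd hpre.length_le (by have := hlen s' h'; omega)
    · exact hpre.eq_of_length (h.1.trans h'.1.symm)
  refine ⟨hM, Omega_eq_one hM (N := k) (fun s hs => ?_) fun w hw => ?_⟩
  · rcases (ht s).1 hs with h | h
    · exact (hlen s h).le
    · exact h.1.le
  · by_cases h : ∃ d ∈ stage c k, d <+: w
    · obtain ⟨d, hd, hdw⟩ := h
      exact ⟨d, (ht d).2 (.inl hd), hdw⟩
    · push Not at h
      exact ⟨w, (ht w).2 (.inr ⟨hw, h⟩), List.prefix_rfl⟩

/-- If no index of a real equal to `1` is enumerated by `f`, then for every effective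
representation of halting probabilities some universal machine has a representation that `f`
does not enumerate. -/
theorem exists_universal_not_enumerated {f : ℕ → Option ℕ} (hf : Primrec f)
    (hone : ∀ i e, f i = some e → ceReal e ≠ 1) {r : ℕ → ℕ} (hr : RepresentsOmega r) :
    ∃ t, IsUniversal t ∧ ∀ i, f i ≠ some (r t) := by
  obtain ⟨c, hc⟩ := exists_universal_code
  have hcu : IsUniversal (Encodable.encode c) :=
    isUniversal_of_prog_eq fun m => by rw [prog, Denumerable.ofNat_encode, hc]
  -- The recursion theorem gives a program that waits for the representation of its own halting
  -- probability.
  obtain ⟨d, hd⟩ := Code.fixed_point₂ (f := fun d => spoiledRun c f (r (Encodable.encode d)))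
    ((partrec₂_spoiledRun c hf).comp (hr.1.comp (Computable.encode.comp Computable.fst))
      Computable.snd)
  have hprog : ∀ m, prog (Encodable.encode d) m = spoiledRun c f (r (Encodable.encode d)) m :=
    fun m => by rw [prog, Denumerable.ofNat_encode, hd]
  have hnot : ∀ i, f i ≠ some (r (Encodable.encode d)) := by
    by_contra! hex
    classical
    have hdom := dom_spoiledRun (c := c) (Nat.find_spec hex) fun j hj => Nat.find_min hex hj
    obtain ⟨hM, hO⟩ := Omega_spoiled_eq_one (t := Encodable.encode d) (k := Nat.find hex) hcu.1
      fun s => by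
        rw [halts_iff, hprog, ← Part.dom_iff_mem, hdom, Denumerable.ofNat_encode, mem_stage]
    -- The function `r` is constrained only on prefix-free machines, so the spoiled program has to
    -- remain one.
    exact hone _ _ (Nat.find_spec hex) ((hr.2 _ hM).trans hO)
  exact ⟨_, isUniversal_of_prog_eq fun m => by rw [hprog, spoiledRun_eq hnot, hc], hnot⟩

end ProvRand

/-! ### The main theorem. -/

theorem mainTheorem10 :
    ∃ f : ℕ → Option ℕ, Primrec f ∧
      (∀ e, (∃ i, f i = some e) ↔ ProvRand.ProvablyRandom e) ∧
      (∃ r : ℕ → ℕ, ProvRand.RepresentsOmega r) ∧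
      ∀ r : ℕ → ℕ, ProvRand.RepresentsOmega r →
        ∃ t : ℕ, ProvRand.IsUniversal t ∧ (∀ i, f i ≠ some (r t)) ∧
          ¬ ProvRand.ProvablyRandom (r t) := by
  obtain ⟨f, hf, hspec⟩ := ProvRand.exists_primrec_enum_provablyRandom
  refine ⟨f, hf, hspec, ProvRand.exists_representsOmega, fun r hr => ?_⟩
  -- Every output of `f` is provably random, so by soundness none represents the real `1`.
  obtain ⟨t, hu, ht⟩ := ProvRand.exists_universal_not_enumerated hf
    (fun i e hi h => ProvRand.not_provablyRandom_of_ceReal_eq_one h ((hspec e).1 ⟨i, hi⟩)) hr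
  exact ⟨t, hu, ht, fun h => ((hspec _).2 h).elim ht⟩
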